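/- **Setting.** Let $X\subset\mathbb R^{N_p}$ be measurable, let $\pi_0\ge 0$ be a measurable prior density on $X$ with $\int_X\pi_0=1$, let $\Sigma_e$ be a positive definite $N_d\times N_d$ matrix with symmetric inverse square root $\Sigma_e^{-1/2}$, let $d_{\rm obs}\in\mathbb R^{N_d}$, and let the forward model $F:X\to\mathbb R^{N_d}$ be Lipschitz continuous and bounded. For $G:X\to\mathbb R^{N_d}$ put $\Phi_G(x)=\frac12\|\Sigma_e^{-1/2}(G(x)-d_{\rm obs})\|^2$ and $\pi_G(x)=Z_G^{-1}e^{-\Phi_G(x)}\pi_0(x)$ with $Z_G=\int_X e^{-\Phi_G}\pi_0\,dx$. The full posterior $\pi=\pi_F$ is identified with the probability measure of density $\pi_F$. Let $q(x,\cdot)$, $x\in X$, be probability densities on $X$, with $q\geq 0$ jointly measurable, let $L\ge1$, and suppose that the proposal is $\pi$-irreducible in the following (one-step) sense: $\int_A q(x,y)\,dy>0$ for every $x$ with $\pi(x)>0$ and every measurable $A$ with $\pi(A)>0$. Let $$G_0=\{x\in X:\ \pi(x)>0 \text{ and } \pi(\{y: q(y,x)>0\})>0\}$$ (if $q>0$ everywhere,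 $G_0$ is the set of all $x$ with $\pi(x)>0$). $\|\cdot\|_{TV}$ denotes total variation distance, $\sup_A|\mu(A)-\nu(A)|$. **Delayed acceptance step for a reduced-order model $F_m$.** Write $\pi_m=\pi_{F_m}$. Given $X_n=x$, run from $Y_1=x$ the Metropolis–Hastings chain with proposal $q$ and acceptance probability $\alpha(y,y')=1\wedge\frac{\pi_m(y')}{\pi_m(y)}\frac{q(y',y)}{q(y,y')}$ for $L$ steps. Let $x'$ be its last state, and set $X_{n+1}=x'$ with probability $\beta(x,x')=1\wedge\frac{\pi(x')}{\pi(x)}\frac{\pi_m(x)}{\pi_m(x')}$ and $X_{n+1}=x$ otherwise. **Lemma.** $\pi(G_0)=1$, and the following hold. (a) *Fixed reduced-order model.* For every Lipschitz continuous and bounded $F_m:X\to\mathbb R^{N_d}$, the transition kernel $P$ of the delayed acceptance step satisfies detailed balance with respect to $\pi$, is irreducible from $G_0$ (for $x\in G_0$ and $\pi(A)>0$ there is $n\ge1$ with $P^n(x,A)>0$), is aperiodic (there are no $d\ge2$ and disjoint measurable $A_0,\dots,A_{d-1}$ with $\pi(A_0)>0$ and $P(x,A_{i+1\bmod d})=1$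 for all $x\in A_i$ and all $i$), and is ergodic: $\|P^n(x,\cdot)-\pi\|_{TV}\to0$ for every $x\in G_0$. (b) *Adaptive algorithm.* Let $F(x)=C(u(x),x)$, where $u:X\to\mathbb R^{N_s}$ is measurable and $u(x)$ solves a discretised system $A(x)u+f(x,u)+g(x)=0$. For an orthonormal reduced basis $V=(v_1,\dots,v_m)$ the reduced-order model is $F_V(x)=C(w_V(x),x)$, where $w_V(x)\in{\rm span}\,V$ and the residual $A(x)w_V(x)+f(x,w_V(x))+g(x)$ is orthogonal to $v_1,\dots,v_m$. Let $M\in\mathbb N$, $\epsilon,c>0$, let $V_0$ be an initial orthonormal basis and let $\hat t_V(x)\in\mathbb R^{N_d}$ be an arbitrary measurable error indicator; let $t_V(x)=\Sigma_e^{-1/2}(F(x)-F_V(x))$. Step $n=0,1,2,\dots$ with current basis $V$ of dimension $m$ is the delayed acceptance step above for $F_V$, with two changes that are in force only as long as the finite adaptation criterion $$\frac{n}{\max(1,\,m-\dim V_0)}>\frac1{c\,\epsilon}$$ (the average number of steps per enrichment exceeds $1/(c\epsilon)$) is not satisfied: the subchain is stopped after a step that leads to a state $y$ with $\|\hat t_V(y)\|_\infty\ge\epsilon$,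 and after the second stage, if $m<M$ and $\|t_V(X_{n+1})\|_\infty\ge\epsilon$, the basis is enriched by Gram–Schmidt with the snapshot $u(x')$ (and is unchanged if $u(x')\in{\rm span}\,V$). Suppose that the reduced-order models $F_V$ are jointly measurable in $(V,x)$ and that, for all $V$ in a measurable class of orthonormal bases that contains $V_0$ and is closed under the enrichments of bases of dimension less than $M$ by snapshots $u(x)$, $x\in X$, the Galerkin state $w_V(x)$ exists for all $x\in X$ and $F_V$ is Lipschitz continuous and bounded on $X$. Then the adaptive algorithm is ergodic: for every $X_0=x\in G_0$, $\|\mathrm{Law}(X_n)-\pi\|_{TV}\to0$. -/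

import Mathlib

open MeasureTheory Filter Topology

-- Subsets of `ℝⁿ` carry the restriction of Lebesgue measure.
attribute [local instance] MeasureTheory.Measure.Subtype.measureSpace

noncomputable section

namespace DelayedAcceptance

/-! ### Bayesian inverse problem -/

/-- Observable outputs, `ℝ^{N_d}` with its Euclidean norm. -/
abbrev Obs (Nd : ℕ) : Type := EuclideanSpace ℝ (Fin Nd)

/-- The coordinates of `Σ^{-1/2} v`, where `Σ^{-1/2}` is the symmetric inverse square root of a
positive definite matrix `Σ`, obtained from the functional calculus. As an element of
`Fin Nd → ℝ` its norm is the maximum norm. -/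
def whiten {Nd : ℕ} (Sig : Matrix (Fin Nd) (Fin Nd) ℝ) (v : Obs Nd) : Fin Nd → ℝ :=
  (cfc (fun t : ℝ => (Real.sqrt t)⁻¹) Sig).mulVec (WithLp.ofLp v)

/-- The data misfit `Φ(x) = ½ ‖Σ^{-1/2} (F(x) - d_obs)‖²` (Euclidean norm). -/
def misfit {S : Type*} {Nd : ℕ} (Sig : Matrix (Fin Nd) (Fin Nd) ℝ) (dobs : Obs Nd)
    (F : S → Obs Nd) (x : S) : ℝ :=
  1 / 2 * ‖(WithLp.toLp 2 (whiten Sig (F x - dobs)) : Obs Nd)‖ ^ 2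

/-- The posterior density `Z⁻¹ exp(-Φ(x)) π₀(x)`, with `Z = ∫ exp(-Φ) π₀`. -/
def posteriorDensity {S : Type*} [MeasureSpace S] {Nd : ℕ} (Sig : Matrix (Fin Nd) (Fin Nd) ℝ)
    (dobs : Obs Nd) (pr : S → ℝ) (F : S → Obs Nd) (x : S) : ℝ :=
  (∫ z, Real.exp (-misfit Sig dobs F z) * pr z)⁻¹ * (Real.exp (-misfit Sig dobs F x) * pr x)

/-- The measure with density `p` with respect to the reference measure. -/
def densityMeasure {S : Type*} [MeasureSpace S] (p : S → ℝ) : Measure S :=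
  (volume : Measure S).withDensity fun x => ENNReal.ofReal (p x)

/-! ### Markov chains (transition laws are functions `P : S → Measure S`) -/

/-- Total variation distance `sup_A |μ(A) - ν(A)|` over measurable sets `A`. -/
def tvDist {S : Type*} [MeasurableSpace S] (μ ν : Measure S) : ℝ :=
  ⨆ A : {A : Set S // MeasurableSet A}, |μ.real A.1 - ν.real A.1|

/-- The law `P^n(x, ·)` after `n` steps of the chain with transition law `P` started at `x`. -/
def nStep {S : Type*} [MeasurableSpace S] (P : S → Measure S) : ℕ → S → Measure S
  | 0, x => Measure.dirac x
  | n + 1, x => (P x).bind (nStep P n)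

/-- Detailed balance: `μ(dx) P(x, dy)` is symmetric. -/
def DetailedBalance {S : Type*} [MeasurableSpace S] (μ : Measure S) (P : S → Measure S) : Prop :=
  ∀ A B : Set S, MeasurableSet A → MeasurableSet B →
    ∫⁻ x in A, P x B ∂μ = ∫⁻ x in B, P x A ∂μ

/-- From every point of `G` the chain reaches every set of positive `μ`-measure. -/
def IrreducibleOn {S : Type*} [MeasurableSpace S] (μ : Measure S) (P : S → Measure S)
    (G : Set S) : Prop :=
  ∀ x ∈ G, ∀ A : Set S, MeasurableSet A → 0 < μ A → ∃ n : ℕ, 1 ≤ n ∧ 0 < nStep P n x A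

/-- There is no cyclic decomposition into `d ≥ 2` disjoint sets, one of positive `μ`-measure,
that the chain visits in turn. -/
def Aperiodic {S : Type*} [MeasurableSpace S] (μ : Measure S) (P : S → Measure S) : Prop :=
  ¬ ∃ (d : ℕ) (A : ℕ → Set S), 2 ≤ d ∧ (∀ i < d, MeasurableSet (A i)) ∧
    (∀ i < d, ∀ j < d, i ≠ j → Disjoint (A i) (A j)) ∧ 0 < μ (A 0) ∧
    ∀ i < d, ∀ x ∈ A i, P x (A ((i + 1) % d)) = 1

/-! ### Two-stage delayed acceptance -/

/-- Go to `y'` with probability `a` and stay at `y` with probability `1 - a`. -/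
def acceptReject {S : Type*} [MeasurableSpace S] (a : ℝ) (y' y : S) : Measure S :=
  ENNReal.ofReal a • Measure.dirac y' + ENNReal.ofReal (1 - a) • Measure.dirac y

/-- First-stage acceptance probability for target density `pm` and proposal density `q`. -/
def firstAccept {S : Type*} (pm : S → ℝ) (q : S → S → ℝ) (y y' : S) : ℝ :=
  min 1 (pm y' / pm y * (q y' y / q y y'))

/-- One Metropolis-Hastings step: draw `y' ∼ q(y, ·)`, then accept or reject. -/
def firstStageStep {S : Type*} [MeasureSpace S] (pm : S → ℝ) (q : S → S → ℝ) (y : S) :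
    Measure S :=
  (densityMeasure (q y)).bind fun y' => acceptReject (firstAccept pm q y y') y' y

open Classical in
/-- Law of the last state of the subchain with step law `K` and maximal length `L` started at `y`:
the subchain is left early as soon as a step has led into `brk`. -/
def subchain {S : Type*} [MeasurableSpace S] (K : S → Measure S) (brk : Set S) :
    ℕ → S → Measure S
  | 0, y => Measure.dirac y
  | i + 1, y => (K y).bind fun y' => if y' ∈ brk then Measure.dirac y' else subchain K brk i y'

/-- Second-stage acceptance probability for full density `p` and approximate density `pm`. -/
def secondAccept {S : Type*} (p pm : S → ℝ) (x x' : S) : ℝ :=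
  min 1 (p x' / p x * (pm x / pm x'))

/-- One step of the non-adaptive algorithm, with the approximation `pm` held fixed: a full
subchain of `L` steps, followed by the second-stage accept/reject step. -/
def delayedStep {S : Type*} [MeasureSpace S] (p pm : S → ℝ) (q : S → S → ℝ) (L : ℕ) (x : S) :
    Measure S :=
  (subchain (firstStageStep pm q) ∅ L x).bind fun x' =>
    acceptReject (secondAccept p pm x x') x' x

/-- `q` is irreducible with respect to the distribution with density `p`: from every point of
positive density, the proposal charges every set of positive probability. -/
def IrreducibleProposal {S : Type*} [MeasureSpace S] (p : S → ℝ) (q : S → S → ℝ) : Prop :=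
  ∀ x, 0 < p x → ∀ A : Set S, MeasurableSet A → 0 < densityMeasure p A →
    0 < densityMeasure (q x) A

/-- Points `x` of positive density `p` that can be proposed from a set of states of positive
probability. If `q > 0` everywhere, these are all points with `p x > 0`. -/
def startingPoints {S : Type*} [MeasureSpace S] (p : S → ℝ) (q : S → S → ℝ) : Set S :=
  {x | 0 < p x ∧ 0 < densityMeasure p {y | 0 < q y x}}

/-! ### Discretised forward model and reduced bases -/

/-- Discretised states `ℝ^{N_s}`. -/
abbrev State (Ns : ℕ) : Type := EuclideanSpace ℝ (Fin Ns)

/-- The discretised system `A(x) u + f(x, u) + g(x) = 0` with observation operator `C(u, x)`. -/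
structure Discretization (S : Type*) (Ns Nd : ℕ) where
  A : S → Matrix (Fin Ns) (Fin Ns) ℝ
  f : S → State Ns → State Ns
  g : S → State Ns
  C : State Ns → S → Obs Nd

/-- The residual `A(x) u + f(x, u) + g(x)`. -/
def Discretization.residual {S : Type*} {Ns Nd : ℕ} (D : Discretization S Ns Nd) (x : S)
    (u : State Ns) : State Ns :=
  WithLp.toLp 2 ((D.A x).mulVec (WithLp.ofLp u)) + D.f x u + D.g x

/-- A reduced basis `v₀, …, v_{m-1}`, stored as `m` together with a sequence of which only the
first `m` entries are used. -/
abbrev ReducedBasis (Ns : ℕ) : Type := ℕ × (ℕ → State Ns)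

/-- `w` is the state `V u_m` given by the Galerkin projection of the system onto the span of the
reduced basis `V`: it lies in the span, and the residual is orthogonal to the basis vectors. -/
def Discretization.IsGalerkinState {S : Type*} {Ns Nd : ℕ} (D : Discretization S Ns Nd)
    (V : ReducedBasis Ns) (x : S) (w : State Ns) : Prop :=
  w ∈ Submodule.span ℝ (V.2 '' {i | i < V.1}) ∧
    ∀ i < V.1, inner ℝ (V.2 i) (D.residual x w) = 0

/-- The component of `u` orthogonal to an orthonormal reduced basis. -/
def orthogonalPart {Ns : ℕ} (V : ReducedBasis Ns) (u : State Ns) : State Ns :=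
  u - ∑ i ∈ Finset.range V.1, (inner ℝ (V.2 i) u : ℝ) • V.2 i

open Classical in
/-- Gram-Schmidt enrichment of `V` by the snapshot `u` (no new vector if `u` is in the span). -/
def enrich {Ns : ℕ} (V : ReducedBasis Ns) (u : State Ns) : ReducedBasis Ns :=
  if orthogonalPart V u = 0 then V
  else (V.1 + 1, Function.update V.2 V.1 (‖orthogonalPart V u‖⁻¹ • orthogonalPart V u))

/-! ### The adaptive algorithm -/

/-- The data of the adaptive algorithm: densities `p` (full posterior) and `pm V` (approximate
posterior for the reduced basis `V`), proposal `q`, full model states `u`, scaled error `t V x`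
and scaled error indicator `tInd V x`, subchain length `L`, maximal dimension `M`, threshold
`ε` and constant `c` of the finite adaptation criterion. -/
structure AdaptiveData (S : Type*) (Ns Nd : ℕ) where
  p : S → ℝ
  pm : ReducedBasis Ns → S → ℝ
  q : S → S → ℝ
  u : S → State Ns
  t : ReducedBasis Ns → S → (Fin Nd → ℝ)
  tInd : ReducedBasis Ns → S → (Fin Nd → ℝ)
  L : ℕ
  M : ℕ
  ε : ℝ
  c : ℝ

/-- Finite adaptation criterion after `n` steps, if the initial basis had `m₀` vectors: the
average number of steps per enrichment exceeds `1 / (c ε)`. Before the second enrichment the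
average is the number `n` of steps itself. -/
def AdaptiveData.finiteAdaptation {S : Type*} {Ns Nd : ℕ} (a : AdaptiveData S Ns Nd)
    (m₀ n : ℕ) (V : ReducedBasis Ns) : Prop :=
  1 / (a.c * a.ε) < (n : ℝ) / (max 1 (V.1 - m₀) : ℕ)

/-- States at which the subchain of step `n` is left early. -/
def AdaptiveData.breakSet {S : Type*} {Ns Nd : ℕ} (a : AdaptiveData S Ns Nd)
    (m₀ n : ℕ) (V : ReducedBasis Ns) : Set S :=
  {y | ¬ a.finiteAdaptation m₀ n V ∧ a.ε ≤ ‖a.tInd V y‖}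

open Classical in
/-- The reduced basis after step `n`, if the candidate was `x'` and the new state is `xn`. -/
def AdaptiveData.nextBasis {S : Type*} {Ns Nd : ℕ} (a : AdaptiveData S Ns Nd)
    (m₀ n : ℕ) (V : ReducedBasis Ns) (x' xn : S) : ReducedBasis Ns :=
  if ¬ a.finiteAdaptation m₀ n V ∧ V.1 < a.M ∧ a.ε ≤ ‖a.t V xn‖ then enrich V (a.u x') else V

/-- Law of `(X_{n+1}, V')` given `(X_n, V)`: one step of the adaptive algorithm. -/
def AdaptiveData.step {S : Type*} [MeasureSpace S] {Ns Nd : ℕ} (a : AdaptiveData S Ns Nd)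
    (m₀ n : ℕ) (s : S × ReducedBasis Ns) : Measure (S × ReducedBasis Ns) :=
  (subchain (firstStageStep (a.pm s.2) a.q) (a.breakSet m₀ n s.2) a.L s.1).bind fun x' =>
    acceptReject (secondAccept a.p (a.pm s.2) s.1 x')
      (x', a.nextBasis m₀ n s.2 x' x') (s.1, a.nextBasis m₀ n s.2 x' s.1)

/-- Joint law of state and reduced basis after `n` steps from state `x₀` and basis `V₀`. -/
def AdaptiveData.law {S : Type*} [MeasureSpace S] {Ns Nd : ℕ} (a : AdaptiveData S Ns Nd)
    (x₀ : S) (V₀ : ReducedBasis Ns) : ℕ → Measure (S × ReducedBasis Ns)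
  | 0 => Measure.dirac (x₀, V₀)
  | n + 1 => (a.law x₀ V₀ n).bind (a.step V₀.1 n)

end DelayedAcceptance

end

/-! Three facts carry the proof: a reversible kernel with enough one-step positivity converges in
total variation, the delayed acceptance kernel is of this type, and adaptation stops at a
deterministic time.

Convergence. Let P be reversible for π. The squared L²(π) norm of P^n f decreases, and each decrease
equals the integral of (P^n f(y) - P^(n+1) f(x))² over π(dx) P(x,dy), which therefore tends to 0. If
π ≪ P(x,·) for almost every x, fixing one good x shows that along a subsequence P^n f is
asymptotically a constant, π-a.e. Invariance of the mean and contraction in L¹ turn this into P^n f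
→ ∫ f dπ in L¹(π) (`tendsto_integral_abs_iterate_sub`). For a chain started at a point x, take a
bounded density b lying below P^n(x,·) with mass almost 1. By self-adjointness the law k steps later
gives A the mass ∫_A P^k b dπ up to a small error, uniformly in A (`abs_nStep_sub_le`). Such a b
exists because P^n(x,·) charges π-null sets only through an atom at x, which decays geometrically
unless π{x} > 0 (`tendsto_tvDist_nStep`).

Positivity. All posteriors are positive exactly where the prior is. One-step irreducibility means
q(x,·) > 0 π-a.e. whenever π(x) > 0, and Fubini then gives q(y,x) > 0 as well for almost every pair.
So from almost every state each set of positive probability is proposed and accepted in both stages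
with positive probability (`delayedStep_pos`); from every point of G₀ this full set of states is
entered in one step with positive probability (`delayedStep_pos_of_null_compl`).

Adaptivity. The number of enrichments is bounded, so the finite adaptation criterion holds at all
times beyond a fixed N. From then on the law is a mixture of fixed-basis chains started in G₀, and
dominated convergence applies (`tendsto_tvDist_bind`). -/

noncomputable section

open ProbabilityTheory

namespace DelayedAcceptance

/-! ### Markov operators -/

section MarkovOperator

variable {S : Type*} [MeasurableSpace S]

/-- Bounded measurable real functions. -/
def BddMeas (f : S → ℝ) : Prop := Measurable f ∧ ∃ C, ∀ x, |f x| ≤ C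

/-- The Markov operator `f ↦ ∫ f(y) κ(·, dy)`. -/
def markovOp (κ : Kernel S S) (f : S → ℝ) (x : S) : ℝ := ∫ y, f y ∂κ x

lemma BddMeas.integrable {f : S → ℝ} (hf : BddMeas f) (μ : Measure S) [IsFiniteMeasure μ] :
    Integrable f μ := by
  obtain ⟨hm, C, hC⟩ := hf
  exact Integrable.of_bound hm.aestronglyMeasurable C (ae_of_all _ hC)

lemma BddMeas.mul {f g : S → ℝ} (hf : BddMeas f) (hg : BddMeas g) :
    BddMeas fun x => f x * g x := by
  obtain ⟨hf, C, hC⟩ := hf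
  obtain ⟨hg, D, hD⟩ := hg
  refine ⟨hf.mul hg, C * D, fun x => ?_⟩
  rw [abs_mul]
  exact mul_le_mul (hC x) (hD x) (abs_nonneg _) ((abs_nonneg _).trans (hC x))

lemma BddMeas.sub {f g : S → ℝ} (hf : BddMeas f) (hg : BddMeas g) :
    BddMeas fun x => f x - g x := by
  obtain ⟨hf, C, hC⟩ := hf
  obtain ⟨hg, D, hD⟩ := hg
  exact ⟨hf.sub hg, C + D, fun x => (abs_sub _ _).trans (add_le_add (hC x) (hD x))⟩

lemma BddMeas.const (c : ℝ) : BddMeas fun _ : S => c := ⟨measurable_const, |c|, fun _ => le_rfl⟩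

lemma BddMeas.abs {f : S → ℝ} (hf : BddMeas f) : BddMeas fun x => |f x| := by
  obtain ⟨hf, C, hC⟩ := hf
  exact ⟨hf.abs, C, fun x => by simpa using hC x⟩

lemma BddMeas.indicator_one {A : Set S} (hA : MeasurableSet A) :
    BddMeas (A.indicator fun _ => (1 : ℝ)) := by
  refine ⟨measurable_const.indicator hA, 1, fun x => ?_⟩
  by_cases h : x ∈ A <;> simp [h]

variable {κ : Kernel S S}

lemma markovOp_nonneg {f : S → ℝ} (h : ∀ x, 0 ≤ f x) (x : S) : 0 ≤ markovOp κ f x :=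
  integral_nonneg h

lemma iterate_nonneg {f : S → ℝ} (h : ∀ x, 0 ≤ f x) (n : ℕ) (x : S) :
    0 ≤ (markovOp κ)^[n] f x := by
  induction n generalizing x with
  | zero => exact h x
  | succ n ih => rw [Function.iterate_succ_apply']; exact markovOp_nonneg ih x

variable [IsMarkovKernel κ]

lemma abs_markovOp_le {f : S → ℝ} {C : ℝ} (hC : ∀ x, |f x| ≤ C) (x : S) :
    |markovOp κ f x| ≤ C := by
  simpa [markovOp] using norm_integral_le_of_norm_le_const (μ := κ x) (f := f) (ae_of_all _ hC)

lemma BddMeas.markovOp {f : S → ℝ} (hf : BddMeas f) : BddMeas (markovOp κ f) := by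
  obtain ⟨hf, C, hC⟩ := hf
  exact ⟨(hf.stronglyMeasurable.integral_kernel (κ := κ)).measurable, C, abs_markovOp_le hC⟩

lemma BddMeas.iterate {f : S → ℝ} (hf : BddMeas f) (n : ℕ) :
    BddMeas ((DelayedAcceptance.markovOp κ)^[n] f) := by
  induction n with
  | zero => exact hf
  | succ n ih => rw [Function.iterate_succ_apply']; exact ih.markovOp

lemma abs_iterate_le {f : S → ℝ} {C : ℝ} (h : ∀ x, |f x| ≤ C) (n : ℕ) (x : S) :
    |(markovOp κ)^[n] f x| ≤ C := by
  induction n generalizing x with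
  | zero => exact h x
  | succ n ih => rw [Function.iterate_succ_apply']; exact abs_markovOp_le ih x

/-- Detailed balance is the symmetry of the joint law on rectangles, which determine a finite
measure. In this form reversibility applies to integrals of arbitrary functions of two states. -/
lemma compProd_map_swap {π : Measure S} [IsFiniteMeasure π]
    (hrev : DetailedBalance π κ) : (π ⊗ₘ κ).map Prod.swap = π ⊗ₘ κ := by
  refine (Measure.ext_prod fun {A B} hA hB => ?_).symm
  rw [Measure.map_apply measurable_swap (hA.prod hB), Set.preimage_swap_prod,
    Measure.compProd_apply_prod hA hB, Measure.compProd_apply_prod hB hA]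
  exact hrev A B hA hB

lemma BddMeas.comp {T : Type*} [MeasurableSpace T] {f : S → ℝ} (hf : BddMeas f) {g : T → S}
    (hg : Measurable g) : BddMeas fun x => f (g x) :=
  ⟨hf.1.comp hg, hf.2.imp fun _ h _ => h _⟩

variable {π : Measure S} [IsProbabilityMeasure π]

/-- Self-adjointness on L²(π): both sides integrate a product against the joint law of two
successive states, which is symmetric. -/
lemma integral_mul_markovOp (hrev : DetailedBalance π κ) {f g : S → ℝ} (hf : BddMeas f)
    (hg : BddMeas g) :
    ∫ x, f x * markovOp κ g x ∂π = ∫ x, markovOp κ f x * g x ∂π := by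
  have key : ∀ {f g : S → ℝ}, BddMeas f → BddMeas g →
      ∫ x, f x * markovOp κ g x ∂π = ∫ s : S × S, f s.1 * g s.2 ∂(π ⊗ₘ κ) := by
    intro f g hf hg
    rw [Measure.integral_compProd
      (((hf.comp measurable_fst).mul (hg.comp measurable_snd)).integrable _)]
    refine integral_congr_ae (ae_of_all _ fun x => ?_)
    simp only [markovOp]
    rw [integral_const_mul]
  rw [key hf hg]
  have : ∫ x, markovOp κ f x * g x ∂π = ∫ x, g x * markovOp κ f x ∂π := by
    simp_rw [mul_comm]
  rw [this, key hg hf]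
  conv_lhs => rw [← compProd_map_swap hrev]
  rw [integral_map measurable_swap.aemeasurable
    ((hf.comp measurable_fst).mul (hg.comp measurable_snd)).1.aestronglyMeasurable]
  simp [mul_comm]

lemma markovOp_one : markovOp κ (fun _ => (1 : ℝ)) = fun _ => 1 := by
  funext x; simp [markovOp]

lemma integral_markovOp (hrev : DetailedBalance π κ) {f : S → ℝ} (hf : BddMeas f) :
    ∫ x, markovOp κ f x ∂π = ∫ x, f x ∂π := by
  have := integral_mul_markovOp hrev (BddMeas.const 1) hf
  simpa [markovOp_one] using this

lemma integral_iterate (hrev : DetailedBalance π κ) {f : S → ℝ} (hf : BddMeas f) (n : ℕ) :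
    ∫ x, (markovOp κ)^[n] f x ∂π = ∫ x, f x ∂π := by
  induction n with
  | zero => rfl
  | succ n ih => simp only [Function.iterate_succ_apply', integral_markovOp hrev (hf.iterate n), ih]

lemma integral_mul_iterate (hrev : DetailedBalance π κ) {f g : S → ℝ} (hf : BddMeas f)
    (hg : BddMeas g) (n : ℕ) :
    ∫ x, f x * (markovOp κ)^[n] g x ∂π = ∫ x, (markovOp κ)^[n] f x * g x ∂π := by
  induction n generalizing f g with
  | zero => rfl
  | succ n ih =>
    simp only [Function.iterate_succ_apply' _ _ g]
    rw [integral_mul_markovOp hrev hf (hg.iterate n), ih hf.markovOp hg]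
    simp only [Function.iterate_succ_apply]

/-- The decrease of the `L²` norm under a Markov operator is a conditional variance. -/
lemma integral_condVar (hrev : DetailedBalance π κ) {f : S → ℝ} (hf : BddMeas f) :
    ∫ s : S × S, (f s.2 - markovOp κ f s.1) ^ 2 ∂(π ⊗ₘ κ)
      = ∫ x, f x * f x ∂π - ∫ x, markovOp κ f x * markovOp κ f x ∂π := by
  have h1 := hf.markovOp (κ := κ).comp (measurable_fst (α := S) (β := S))
  have h2 := hf.comp (measurable_snd (α := S) (β := S))
  have e : (fun s : S × S => (f s.2 - markovOp κ f s.1) ^ 2)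
      = fun s => (f s.2 * f s.2 - markovOp κ f s.1 * f s.2)
        - (markovOp κ f s.1 * f s.2 - markovOp κ f s.1 * markovOp κ f s.1) := by
    funext s; ring
  have i12 := (h1.mul h2).integrable (π ⊗ₘ κ)
  have i11 := (h1.mul h1).integrable (π ⊗ₘ κ)
  have i22 := (h2.mul h2).integrable (π ⊗ₘ κ)
  -- Given the first coordinate, the second factor averages to `markovOp κ f`, so the cross term
  -- equals the squared norm of `markovOp κ f`.
  have E12 : ∫ s : S × S, markovOp κ f s.1 * f s.2 ∂(π ⊗ₘ κ)
      = ∫ x, markovOp κ f x * markovOp κ f x ∂π := by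
    rw [Measure.integral_compProd i12]
    simp only [integral_const_mul]
    rfl
  have E11 : ∫ s : S × S, markovOp κ f s.1 * markovOp κ f s.1 ∂(π ⊗ₘ κ)
      = ∫ x, markovOp κ f x * markovOp κ f x ∂π := by
    rw [Measure.integral_compProd i11]; simp
  have E22 : ∫ s : S × S, f s.2 * f s.2 ∂(π ⊗ₘ κ) = ∫ x, f x * f x ∂π := by
    rw [Measure.integral_compProd i22]
    exact integral_markovOp hrev (hf.mul hf)
  rw [e]
  refine (integral_sub (i22.sub i12) (i12.sub i11)).trans
    ((congrArg₂ (· - ·) (integral_sub i22 i12) (integral_sub i12 i11)).trans ?_)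
  simp only [E12, E11, E22]
  ring

/-- Jensen pointwise, then invariance of `π`. With `c` the mean, this makes the L¹ distance to
equilibrium monotone, so that a subsequence decides convergence. -/
lemma integral_abs_markovOp_sub_le (hrev : DetailedBalance π κ) {f : S → ℝ} (hf : BddMeas f)
    (c : ℝ) : ∫ x, |markovOp κ f x - c| ∂π ≤ ∫ x, |f x - c| ∂π := by
  have hfc := (hf.sub (.const c)).abs
  rw [← integral_markovOp hrev hfc]
  refine integral_mono (((hf.markovOp.sub (.const c)).abs).integrable _)
    (hfc.markovOp.integrable _) fun x => ?_
  have : markovOp κ f x - c = ∫ y, (f y - c) ∂κ x := by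
    rw [integral_sub (hf.integrable _) (integrable_const _)]; simp [markovOp]
  simp only [this]
  exact abs_integral_le_integral_abs

end MarkovOperator

/-! ### L¹ convergence of the iterates of a reversible Markov operator -/

section Ergodic

variable {S : Type*} [MeasurableSpace S] {κ : Kernel S S} [IsMarkovKernel κ]
  {π : Measure S} [IsProbabilityMeasure π]

/-- The integrals are the successive differences of the squared norms `a n`, a decreasing sequence
bounded below by 0. -/
lemma tendsto_integral_condVar (hrev : DetailedBalance π κ) {f : S → ℝ} (hf : BddMeas f) :
    Tendsto (fun n => ∫ s : S × S,
      ((markovOp κ)^[n] f s.2 - (markovOp κ)^[n + 1] f s.1) ^ 2 ∂(π ⊗ₘ κ)) atTop (𝓝 0) := by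
  set a : ℕ → ℝ := fun n => ∫ x, (markovOp κ)^[n] f x * (markovOp κ)^[n] f x ∂π
  have e : ∀ n, ∫ s : S × S,
      ((markovOp κ)^[n] f s.2 - (markovOp κ)^[n + 1] f s.1) ^ 2 ∂(π ⊗ₘ κ) = a n - a (n + 1) := by
    intro n
    simp only [a, Function.iterate_succ_apply', integral_condVar hrev (hf.iterate n)]
  have ha : Antitone a := antitone_nat_of_succ_le fun n => by
    have : 0 ≤ a n - a (n + 1) := by rw [← e]; exact integral_nonneg fun _ => sq_nonneg _
    linarith
  have hb : BddBelow (Set.range a) :=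
    ⟨0, by rintro _ ⟨n, rfl⟩; exact integral_nonneg fun _ => mul_self_nonneg _⟩
  have ht := tendsto_atTop_ciInf ha hb
  simp only [e]
  simpa using ht.sub (ht.comp (tendsto_add_atTop_nat 1))

/-- If `π`-almost every point reaches all sets of positive measure in one step, the iterates of the
Markov operator converge to the mean in `L¹(π)`. -/
lemma tendsto_integral_abs_iterate_sub (hrev : DetailedBalance π κ)
    (hpos : ∀ᵐ x ∂π, π ≪ κ x) {f : S → ℝ} (hf : BddMeas f) :
    Tendsto (fun n => ∫ x, |(markovOp κ)^[n] f x - ∫ y, f y ∂π| ∂π) atTop (𝓝 0) := by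
  obtain ⟨C, hC⟩ := hf.2
  set F : ℕ → S → ℝ := fun n => (markovOp κ)^[n] f
  have hF : ∀ n, BddMeas (F n) := fun n => hf.iterate n
  have hFC : ∀ n x, |F n x| ≤ C := abs_iterate_le hC
  set D : ℕ → S × S → ℝ := fun n s => (F n s.2 - F (n + 1) s.1) ^ 2
  have hD : ∀ n, Integrable (D n) (π ⊗ₘ κ) := fun n => by
    have h := ((hF n).comp (measurable_snd (α := S))).sub
      ((hF (n + 1)).comp (measurable_fst (β := S)))
    simpa only [D, sq] using (h.mul h).integrable _
  have hDm : TendstoInMeasure (π ⊗ₘ κ) D atTop (fun _ => 0) := by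
    refine tendstoInMeasure_of_tendsto_eLpNorm (p := 1) one_ne_zero
      (fun n => (hD n).aestronglyMeasurable) aestronglyMeasurable_const ?_
    have h0 := tendsto_integral_condVar hrev hf
    have : ∀ n, eLpNorm (D n - fun _ => 0) 1 (π ⊗ₘ κ)
        = ENNReal.ofReal (∫ s, D n s ∂(π ⊗ₘ κ)) := by
      intro n
      rw [ofReal_integral_eq_lintegral_ofReal (hD n) (ae_of_all _ fun _ => sq_nonneg _),
        eLpNorm_one_eq_lintegral_enorm]
      refine lintegral_congr fun s => ?_
      simp only [Pi.sub_apply, sub_zero]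
      rw [Real.enorm_of_nonneg (sq_nonneg _)]
    simp only [this]
    have h1 := ENNReal.tendsto_ofReal h0
    rwa [ENNReal.ofReal_zero] at h1
  obtain ⟨ns, hns, hae⟩ := hDm.exists_seq_tendsto_ae
  have hae' := Measure.ae_ae_of_ae_compProd hae
  -- One good point `x` is enough: convergence for `κ x`-almost every `y` transfers to `π`-almost
  -- every `y` because `π ≪ κ x`, and `b k` does not depend on `y`.
  obtain ⟨x, hx, hxκ⟩ := (hpos.and hae').exists
  set b : ℕ → ℝ := fun k => F (ns k + 1) x
  have hlim : ∀ᵐ y ∂π, Tendsto (fun k => |F (ns k) y - b k|) atTop (𝓝 0) := by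
    filter_upwards [hx.ae_le hxκ] with y hy
    have := (Real.continuous_sqrt.tendsto 0).comp hy
    simpa [D, Function.comp_def, Real.sqrt_sq_eq_abs] using this
  have hint : Tendsto (fun k => ∫ y, |F (ns k) y - b k| ∂π) atTop (𝓝 0) := by
    have := tendsto_integral_of_dominated_convergence (μ := π)
      (F := fun k y => |F (ns k) y - b k|) (f := fun _ => 0) (fun _ => C + C)
      (fun k => (((hF (ns k)).sub (.const (b k))).abs.1).aestronglyMeasurable)
      (integrable_const _) (fun k => ae_of_all _ fun y => by
        simpa using (abs_sub _ _).trans (add_le_add (hFC (ns k) y) (hFC _ x))) hlim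
    simpa using this
  -- The iterates keep their mean, so the constants that approximate them must approach it.
  have hmean : ∀ k, |b k - ∫ y, f y ∂π| ≤ ∫ y, |F (ns k) y - b k| ∂π := by
    intro k
    have e : ∫ y, f y ∂π - b k = ∫ y, (F (ns k) y - b k) ∂π := by
      rw [integral_sub ((hF _).integrable _) (integrable_const _), integral_iterate hrev hf]
      simp
    rw [abs_sub_comm, e]
    exact abs_integral_le_integral_abs
  have hle : ∀ k, ∫ x, |F (ns k) x - ∫ y, f y ∂π| ∂π ≤ 2 * ∫ y, |F (ns k) y - b k| ∂π := by
    intro k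
    have i1 := (((hF (ns k)).sub (.const (b k))).abs).integrable π
    have : ∫ x, |F (ns k) x - ∫ y, f y ∂π| ∂π
        ≤ ∫ x, (|F (ns k) x - b k| + |b k - ∫ y, f y ∂π|) ∂π :=
      integral_mono ((((hF (ns k)).sub (.const _)).abs).integrable π)
        (i1.add (integrable_const _)) fun x => abs_sub_le _ _ _
    rw [integral_add i1 (integrable_const _)] at this
    simp only [integral_const, probReal_univ, smul_eq_mul, one_mul] at this
    linarith [hmean k]
  have hsub : Tendsto (fun k => ∫ x, |F (ns k) x - ∫ y, f y ∂π| ∂π) atTop (𝓝 0) :=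
    squeeze_zero (fun _ => integral_nonneg fun _ => abs_nonneg _) hle (by simpa using hint.const_mul 2)
  have hanti : Antitone fun n => ∫ x, |F n x - ∫ y, f y ∂π| ∂π :=
    antitone_nat_of_succ_le fun n => by
      simp only [F, Function.iterate_succ_apply']
      exact integral_abs_markovOp_sub_le hrev (hF n) _
  rw [Metric.tendsto_atTop] at hsub ⊢
  intro ε hε
  obtain ⟨k, hk⟩ := hsub ε hε
  refine ⟨ns k, fun n hn => ?_⟩
  have h0 : ∀ n, 0 ≤ ∫ x, |F n x - ∫ y, f y ∂π| ∂π := fun n =>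
    integral_nonneg fun _ => abs_nonneg _
  have := hk k le_rfl
  rw [Real.dist_eq, sub_zero, abs_of_nonneg (h0 _)] at this ⊢
  exact (hanti hn).trans_lt this

/-! ### Laws after several steps -/

lemma measurable_nStep {P : S → Measure S} (hP : Measurable P) (n : ℕ) : Measurable (nStep P n) := by
  induction n with
  | zero => exact Measure.measurable_dirac
  | succ n ih => exact (Measure.measurable_bind' ih).comp hP

lemma nStep_apply_succ {P : S → Measure S} (hP : Measurable P) (n : ℕ) (x : S) {A : Set S}
    (hA : MeasurableSet A) : nStep P (n + 1) x A = ∫⁻ y, nStep P n y A ∂P x :=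
  Measure.bind_apply hA (measurable_nStep hP n).aemeasurable

/-- Chapman-Kolmogorov. `nStep` unfolds at the first step; this is what allows the last step to be
split off. -/
lemma nStep_add {P : S → Measure S} (hP : Measurable P) (m n : ℕ) (x : S) :
    nStep P (m + n) x = (nStep P m x).bind (nStep P n) := by
  induction m generalizing x with
  | zero => rw [Nat.zero_add]; exact (Measure.dirac_bind (measurable_nStep hP n) x).symm
  | succ m ih =>
    rw [Nat.succ_add]
    change (P x).bind (nStep P (m + n)) = ((P x).bind (nStep P m)).bind (nStep P n)
    rw [Measure.bind_bind (measurable_nStep hP m).aemeasurable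
      (measurable_nStep hP n).aemeasurable]
    congr 1
    funext y
    exact ih y

lemma nStep_one {P : S → Measure S} (x : S) : nStep P 1 x = P x :=
  Measure.bind_dirac

instance isProbabilityMeasure_nStep (n : ℕ) (x : S) : IsProbabilityMeasure (nStep κ n x) := by
  induction n generalizing x with
  | zero => exact Measure.dirac.isProbabilityMeasure
  | succ n ih => 
    constructor
    rw [nStep_apply_succ κ.measurable n x .univ]
    simp

lemma nStep_real_eq_iterate (n : ℕ) (x : S) {A : Set S} (hA : MeasurableSet A) :
    (nStep κ n x).real A = (markovOp κ)^[n] (A.indicator fun _ => 1) x := by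
  induction n generalizing x with
  | zero =>
    simp only [nStep, Function.iterate_zero, id, Measure.real, Measure.dirac_apply' _ hA]
    by_cases h : x ∈ A <;> simp [h]
  | succ n ih =>
    rw [Function.iterate_succ_apply']
    simp only [markovOp]
    rw [Measure.real, nStep_apply_succ κ.measurable n x hA, ← integral_toReal]
    · exact integral_congr_ae (ae_of_all _ fun y => ih y)
    · exact ((Measure.measurable_coe hA).comp (measurable_nStep κ.measurable n)).aemeasurable
    · exact ae_of_all _ fun y => measure_lt_top _ _

lemma nStep_add_real (m n : ℕ) (x : S) {A : Set S} (hA : MeasurableSet A) :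
    (nStep κ (m + n) x).real A
      = ∫ y, (markovOp κ)^[n] (A.indicator fun _ => 1) y ∂nStep κ m x := by
  rw [nStep_add κ.measurable, Measure.real,
    Measure.bind_apply hA (measurable_nStep κ.measurable n).aemeasurable, ← integral_toReal]
  · exact integral_congr_ae (ae_of_all _ fun y => nStep_real_eq_iterate n y hA)
  · exact ((Measure.measurable_coe hA).comp (measurable_nStep κ.measurable n)).aemeasurable
  · exact ae_of_all _ fun y => measure_lt_top _ _

/-! ### Total variation distance -/

lemma tvDist_nonneg (μ ν : Measure S) : 0 ≤ tvDist μ ν :=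
  Real.iSup_nonneg fun _ => abs_nonneg _

lemma tvDist_le {μ ν : Measure S} {c : ℝ}
    (h : ∀ A, MeasurableSet A → |μ.real A - ν.real A| ≤ c) : tvDist μ ν ≤ c :=
  haveI : Nonempty {A : Set S // MeasurableSet A} := ⟨⟨∅, .empty⟩⟩
  ciSup_le fun A => h A.1 A.2

lemma le_tvDist (μ ν : Measure S) [IsProbabilityMeasure μ] [IsProbabilityMeasure ν] {A : Set S}
    (hA : MeasurableSet A) : |μ.real A - ν.real A| ≤ tvDist μ ν := by
  -- A real supremum is meaningful only for a bounded family; masses of probability measures give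
  -- the bound 1.
  refine le_ciSup (f := fun A : {A : Set S // MeasurableSet A} => |μ.real A.1 - ν.real A.1|)
    ⟨1, ?_⟩ ⟨A, hA⟩
  rintro _ ⟨B, rfl⟩
  have h1 := measureReal_nonneg (μ := μ) (s := B.1)
  have h2 := measureReal_nonneg (μ := ν) (s := B.1)
  have h3 := measureReal_le_one (μ := μ) (s := B.1)
  have h4 := measureReal_le_one (μ := ν) (s := B.1)
  exact abs_le.2 ⟨by linarith, by linarith⟩

end Ergodic

/-! ### Total variation convergence from a given starting point -/

section Convergence

variable {S : Type*} [MeasurableSpace S] {κ : Kernel S S} [IsMarkovKernel κ]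
  {π : Measure S} [IsProbabilityMeasure π]

lemma bind_apply_eq_zero {T : Type*} [MeasurableSpace T] {μ : Measure T} {g : T → Measure S}
    (hg : Measurable g) {B : Set S} (hB : MeasurableSet B) (h : ∀ᵐ y ∂μ, g y B = 0) :
    μ.bind g B = 0 := by
  rw [Measure.bind_apply hB hg.aemeasurable]
  exact (lintegral_congr_ae h).trans lintegral_zero

lemma bind_apply_pos {T : Type*} [MeasurableSpace T] {μ : Measure T} {g : T → Measure S}
    (hg : Measurable g) {B : Set S} (hB : MeasurableSet B) {C : Set T} (hC : 0 < μ C)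
    (h : ∀ᵐ y ∂μ, y ∈ C → 0 < g y B) : 0 < μ.bind g B := by
  rw [pos_iff_ne_zero, Measure.bind_apply hB hg.aemeasurable]
  intro h0
  rw [lintegral_eq_zero_iff (f := fun y => g y B) ((Measure.measurable_coe hB).comp hg)] at h0
  refine hC.ne' (measure_eq_zero_iff_ae_notMem.2 ?_)
  filter_upwards [h, h0] with y hy hy0 hyC
  exact (hy hyC).ne' hy0

/-- Split the law at time `n` into the part with density `b` and a remainder. By self-adjointness
the first part gives `A` the mass `∫_A P^k b dπ` after `k` further steps, close to `(∫ b) π(A)`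
uniformly in `A`. The remainder and the deficit `(1 - ∫ b) π(A)` cost at most `1 - ∫ b` each. -/
lemma abs_nStep_sub_le (hrev : DetailedBalance π κ) {x : S} {n : ℕ} {b : S → ℝ} (hb : BddMeas b)
    (hb0 : ∀ y, 0 ≤ b y)
    (hle : π.withDensity (fun y => ENNReal.ofReal (b y)) ≤ nStep κ n x) (k : ℕ) {A : Set S}
    (hA : MeasurableSet A) :
    |(nStep κ (n + k) x).real A - π.real A|
      ≤ ∫ y, |(markovOp κ)^[k] b y - ∫ z, b z ∂π| ∂π + 2 * (1 - ∫ z, b z ∂π) := by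
  set ν := nStep κ n x
  set β := π.withDensity fun y => ENNReal.ofReal (b y)
  have : IsFiniteMeasure β := isFiniteMeasure_of_le ν hle
  set g := (markovOp κ)^[k] (A.indicator fun _ => 1)
  have h1A : BddMeas (A.indicator fun _ => (1 : ℝ)) := .indicator_one hA
  have hg : BddMeas g := h1A.iterate k
  have hg0 : ∀ y, 0 ≤ g y := iterate_nonneg (Set.indicator_nonneg fun _ _ => zero_le_one) k
  have hg1 : ∀ y, g y ≤ 1 := fun y => (le_abs_self _).trans (abs_iterate_le (fun y => by
    by_cases h : y ∈ A <;> simp [h]) k y)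
  have hν : ν = (ν - β) + β := (Measure.sub_add_cancel_of_le hle).symm
  have hβ : ∀ f : S → ℝ, BddMeas f → ∫ y, f y ∂β = ∫ y, b y * f y ∂π := fun f _ => by
    rw [integral_withDensity_eq_integral_toReal_smul (by have := hb.1; fun_prop)
      (ae_of_all _ fun _ => ENNReal.ofReal_lt_top)]
    simp [ENNReal.toReal_ofReal (hb0 _)]
  have hsum : ∀ f : S → ℝ, BddMeas f → ∫ y, f y ∂ν = ∫ y, f y ∂(ν - β) + ∫ y, b y * f y ∂π :=
    fun f hf => by
      rw [← hβ f hf]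
      conv_lhs => rw [hν]
      exact integral_add_measure (hf.integrable _) (hf.integrable _)
  have hmass := hsum _ (.const 1)
  have hG := hsum g hg
  simp only [integral_const, probReal_univ, smul_eq_mul, mul_one] at hmass
  have hs0 : 0 ≤ ∫ y, g y ∂(ν - β) := integral_nonneg hg0
  have hs1 : ∫ y, g y ∂(ν - β) ≤ (ν - β).real Set.univ := by
    have := integral_mono (hg.integrable (ν - β)) (integrable_const 1) hg1
    simpa using this
  have hdual : ∫ y, b y * g y ∂π = ∫ y, (markovOp κ)^[k] b y * A.indicator (fun _ => 1) y ∂π :=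
    integral_mul_iterate hrev hb h1A k
  have hπA : ∫ y, A.indicator (fun _ => (1 : ℝ)) y ∂π = π.real A := by
    rw [integral_indicator hA]; simp
  have hmain : |∫ y, b y * g y ∂π - (∫ z, b z ∂π) * π.real A|
      ≤ ∫ y, |(markovOp κ)^[k] b y - ∫ z, b z ∂π| ∂π := by
    have hbk : BddMeas ((markovOp κ)^[k] b) := hb.iterate k
    rw [hdual, ← hπA, ← integral_const_mul,
      ← integral_sub ((hbk.mul h1A).integrable _) ((h1A.integrable _).const_mul _)]
    refine abs_integral_le_integral_abs.trans (integral_mono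
      (((hbk.mul h1A).sub ((BddMeas.const _).mul h1A)).abs.integrable _)
      ((hbk.sub (.const _)).abs.integrable _) fun y => ?_)
    by_cases h : y ∈ A <;> simp [h]
  rw [nStep_add_real n k x hA, hG]
  have hA0 : 0 ≤ π.real A := measureReal_nonneg
  have hA1 : π.real A ≤ 1 := measureReal_le_one
  have hs : (ν - β).real Set.univ = 1 - ∫ z, b z ∂π := by linarith
  have hd : 0 ≤ 1 - ∫ z, b z ∂π := hs ▸ measureReal_nonneg
  have h2 := abs_le.1 hmain
  refine abs_le.2 ⟨?_, ?_⟩ <;> nlinarith [mul_nonneg hd hA0, mul_nonneg hd (sub_nonneg.2 hA1)]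

/-- Truncate the Radon-Nikodym density at a high level `k`; by monotone convergence little mass is
lost. Boundedness is what the L¹ convergence of the iterates asks of `b`. -/
lemma exists_bddMeas_density_le {a : Measure S} [IsFiniteMeasure a] (ha : a ≪ π) {η : ℝ}
    (hη : 0 < η) :
    ∃ b : S → ℝ, BddMeas b ∧ (∀ y, 0 ≤ b y) ∧
      π.withDensity (fun y => ENNReal.ofReal (b y)) ≤ a ∧ a.real Set.univ - η < ∫ z, b z ∂π := by
  set h := a.rnDeriv π
  have hm : Measurable h := Measure.measurable_rnDeriv a π
  have hfin : ∀ (k : ℕ) y, min (h y) k ≠ ⊤ := fun k y =>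
    ((min_le_right _ _).trans_lt (ENNReal.natCast_lt_top k)).ne
  have hha : ∫⁻ y, h y ∂π = a Set.univ := by
    rw [← setLIntegral_univ, Measure.setLIntegral_rnDeriv ha]
  have hconv : Tendsto (fun k : ℕ => ∫⁻ y, min (h y) k ∂π) atTop (𝓝 (a Set.univ)) := by
    rw [← hha]
    refine lintegral_tendsto_of_tendsto_of_monotone
      (fun k => (hm.min measurable_const).aemeasurable)
      (ae_of_all _ fun y i j hij => min_le_min le_rfl (by exact_mod_cast hij)) (ae_of_all _ ?_)
    intro y
    simpa using (tendsto_const_nhds (x := h y)).min ENNReal.tendsto_nat_nhds_top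
  have hreal : ∀ k : ℕ, ∫ y, (min (h y) k).toReal ∂π = (∫⁻ y, min (h y) k ∂π).toReal := fun k =>
    integral_toReal (hm.min measurable_const).aemeasurable
      (ae_of_all _ fun y => (hfin k y).lt_top)
  have hconv' := (ENNReal.tendsto_toReal (measure_ne_top a Set.univ)).comp hconv
  obtain ⟨k, hk⟩ := ((tendsto_order.1 hconv').1 (a.real Set.univ - η)
    (by change _ < a.real Set.univ; linarith)).exists
  refine ⟨fun y => (min (h y) k).toReal, ⟨(hm.min measurable_const).ennreal_toReal, k, fun y => ?_⟩,
    fun y => ENNReal.toReal_nonneg, ?_, by rw [hreal]; exact hk⟩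
  · rw [abs_of_nonneg ENNReal.toReal_nonneg]
    exact ENNReal.toReal_le_of_le_ofReal (Nat.cast_nonneg k) (by simp)
  · conv_rhs => rw [← Measure.withDensity_rnDeriv_eq a π ha]
    refine withDensity_mono (ae_of_all _ fun y => ?_)
    simp only [ENNReal.ofReal_toReal (hfin k y)]
    exact min_le_left _ _

lemma tendsto_tvDist_of_absolutelyContinuous_part (hrev : DetailedBalance π κ)
    (hpos : ∀ᵐ x ∂π, π ≪ κ x) {x : S}
    (hx : ∀ η : ℝ, 0 < η → ∃ (n : ℕ) (a : Measure S), a ≤ nStep κ n x ∧ a ≪ π ∧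
      1 - η < a.real Set.univ) :
    Tendsto (fun n => tvDist (nStep κ n x) π) atTop (𝓝 0) := by
  rw [Metric.tendsto_atTop]
  intro ε hε
  -- Two losses of `ε / 8` leave `∫ b > 1 - ε / 4`, so the final bound is below `ε / 4 + 2 * (ε / 4)
  -- < ε`.
  obtain ⟨n, a, han, haπ, hmass⟩ := hx (ε / 8) (by positivity)
  have : IsFiniteMeasure a := isFiniteMeasure_of_le _ han
  obtain ⟨b, hb, hb0, hba, hbm⟩ := exists_bddMeas_density_le haπ (η := ε / 8) (by positivity)
  obtain ⟨k₀, hk₀⟩ := Metric.tendsto_atTop.1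
    (tendsto_integral_abs_iterate_sub hrev hpos hb) (ε / 4) (by positivity)
  refine ⟨n + k₀, fun m hm => ?_⟩
  obtain ⟨k, rfl⟩ := Nat.exists_eq_add_of_le hm
  have h1 := hk₀ (k₀ + k) (by omega)
  rw [Real.dist_eq, sub_zero, abs_of_nonneg (integral_nonneg fun _ => abs_nonneg _)] at h1
  rw [Real.dist_eq, sub_zero, abs_of_nonneg (tvDist_nonneg _ _), add_assoc]
  refine (tvDist_le fun A hA =>
    abs_nStep_sub_le hrev hb hb0 (hba.trans han) (k₀ + k) hA).trans_lt ?_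
  linarith

/-- From each point, the law charges no `π`-null set that does not contain the point. -/
def NullAvoiding (π : Measure S) (P : S → Measure S) : Prop :=
  ∀ x B, MeasurableSet B → π B = 0 → x ∉ B → P x B = 0

-- Rejections leave an atom at the current point, hence the exception `x ∉ B`. It survives
-- composition: after one step the chain is almost surely still outside `B`.
omit [IsMarkovKernel κ] [IsProbabilityMeasure π] in
lemma NullAvoiding.nStep (h : NullAvoiding π κ) (n : ℕ) :
    NullAvoiding π (DelayedAcceptance.nStep κ n) := by
  induction n with
  | zero =>
    intro x B hB _ hx
    simp [DelayedAcceptance.nStep, Measure.dirac_apply' _ hB, hx]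
  | succ n ih =>
    intro x B hB hπ hx
    have : ∀ᵐ y ∂κ x, y ∉ B := measure_eq_zero_iff_ae_notMem.1 (h x B hB hπ hx)
    refine bind_apply_eq_zero (measurable_nStep κ.measurable n) hB ?_
    filter_upwards [this] with y hy using ih y B hB hπ hy

-- A null singleton is never re-entered from another point, so being at `x` at time `n` means having
-- stayed there at all `n` steps.
omit [IsMarkovKernel κ] [IsProbabilityMeasure π] in
lemma nStep_singleton [MeasurableSingletonClass S] (h : NullAvoiding π κ) {x : S}
    (hx : π {x} = 0) (n : ℕ) : nStep κ n x {x} = (κ x {x}) ^ n := by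
  induction n with
  | zero => simp [nStep]
  | succ n ih =>
    rw [nStep_apply_succ κ.measurable n x (measurableSet_singleton x),
      ← lintegral_add_compl _ (measurableSet_singleton x), lintegral_singleton, ih, pow_succ]
    have : ∫⁻ y in {x}ᶜ, nStep κ n y {x} ∂κ x = 0 := by
      rw [setLIntegral_congr_fun (g := fun _ => 0) (measurableSet_singleton x).compl]
      · simp
      · intro y hy
        exact h.nStep n y {x} (measurableSet_singleton x) hx fun e => hy (Set.mem_singleton_iff.1 e ▸ rfl)
    rw [this, add_zero]

/-- Convergence in total variation of a reversible chain, from a starting point that is left with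
positive probability. -/
theorem tendsto_tvDist_nStep [MeasurableSingletonClass S] (hrev : DetailedBalance π κ)
    (hpos : ∀ᵐ x ∂π, π ≪ κ x) (hnull : NullAvoiding π κ) {x : S}
    (hx : ∀ B, MeasurableSet B → π Bᶜ = 0 → 0 < κ x B) :
    Tendsto (fun n => tvDist (nStep κ n x) π) atTop (𝓝 0) := by
  have hsing := measurableSet_singleton x
  refine tendsto_tvDist_of_absolutelyContinuous_part hrev hpos fun η hη => ?_
  by_cases h0 : π {x} = 0
  -- If `{x}` is null, its complement has full measure and is charged from `x`. The atom then decays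
  -- geometrically, and the rest of the law is absolutely continuous.
  · have hr : κ x {x} < 1 := by
      have := hx {x}ᶜ hsing.compl (by rwa [compl_compl])
      rw [prob_compl_eq_one_sub hsing] at this
      exact tsub_pos_iff_lt.1 this
    have hr' : (κ x).real {x} < 1 := by
      simpa [Measure.real] using
        (ENNReal.toReal_lt_toReal (measure_ne_top _ _) ENNReal.one_ne_top).2 hr
    obtain ⟨n, hn⟩ := exists_pow_lt_of_lt_one hη hr'
    refine ⟨n, (nStep κ n x).restrict {x}ᶜ, Measure.restrict_le_self, ?_, ?_⟩
    · refine Measure.AbsolutelyContinuous.mk fun B hB hπ => ?_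
      rw [Measure.restrict_apply hB]
      exact hnull.nStep n x _ (hB.inter hsing.compl) (measure_mono_null Set.inter_subset_left hπ)
        fun h => h.2 rfl
    · rw [measureReal_restrict_apply .univ, Set.univ_inter, probReal_compl_eq_one_sub hsing]
      have : (nStep κ n x).real {x} = (κ x).real {x} ^ n := by
        rw [Measure.real, nStep_singleton hnull h0, ENNReal.toReal_pow]; rfl
      rw [this]
      linarith
  -- If `x` is an atom of `π`, the initial Dirac mass is already absolutely continuous.
  · refine ⟨0, Measure.dirac x, le_rfl, ?_, ?_⟩
    · refine Measure.AbsolutelyContinuous.mk fun B hB hπ => ?_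
      have : x ∉ B := fun h => h0 (measure_mono_null (Set.singleton_subset_iff.2 h) hπ)
      simp [Measure.dirac_apply' _ hB, this]
    · simpa using hη

end Convergence

/-! ### Mixtures -/

section Mixture

variable {E S : Type*} [MeasurableSpace E] [MeasurableSpace S]
  [MeasurableSpace.CountablyGenerated S] {π : Measure S} [IsProbabilityMeasure π]

/-- A supremum over uncountably many sets need not be measurable in `s`. The substitute is `D s = ∫
(1 - f s)⁺ dπ` with `f s` the density of the absolutely continuous part of `κ s`; a countably
generated σ-algebra makes it jointly measurable. The one-sided estimate suffices, the other side
following by complements. -/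
lemma exists_measurable_le_tvDist (κ : Kernel E S) [IsMarkovKernel κ] :
    ∃ D : E → ENNReal, Measurable D ∧ (∀ s, D s ≤ 1) ∧
      (∀ s, D s ≤ ENNReal.ofReal (tvDist (κ s) π)) ∧
      ∀ s A, MeasurableSet A → π A ≤ κ s A + D s := by
  set η : Kernel E S := Kernel.const E π
  set f : E → S → ENNReal := κ.rnDeriv η
  have hf : Measurable fun q : E × S => f q.1 q.2 := Kernel.measurable_rnDeriv κ η
  have hfs : ∀ s, Measurable (f s) := fun s => hf.comp measurable_prodMk_left
  have hκ : ∀ s, (π.withDensity (f s)) + κ.singularPart η s = κ s := fun s => by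
    conv_rhs => rw [← Kernel.rnDeriv_add_singularPart κ η]
    rw [_root_.add_apply, Kernel.withDensity_apply _ (Kernel.measurable_rnDeriv κ η)]
    rfl
  refine ⟨fun s => ∫⁻ y, (1 - f s y) ∂π, ?_, fun s => ?_, fun s => ?_, fun s A hA => ?_⟩
  · exact (measurable_const.sub hf).lintegral_prod_right'
  · calc ∫⁻ y, (1 - f s y) ∂π ≤ ∫⁻ _, 1 ∂π := lintegral_mono fun y => tsub_le_self
      _ = 1 := by simp
  · obtain ⟨N, hN, hN1, hN2⟩ := Kernel.mutuallySingular_singularPart κ η s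
    -- `N` carries `π` and is null for the singular part, so `κ s` has density `f s` on `B`. Thus `D
    -- s = π B - κ s B`, a difference that `tvDist` dominates.
    set B := {y | f s y < 1} ∩ N
    have hB : MeasurableSet B := (measurableSet_lt (hfs s) measurable_const).inter hN
    have hN2' : ∀ᵐ y ∂π, y ∈ N := mem_ae_iff.2 (by simpa [η] using hN2)
    have hκB : κ s B = ∫⁻ y in B, f s y ∂π := by
      rw [← hκ s, Measure.add_apply, withDensity_apply _ hB,
        measure_mono_null Set.inter_subset_right hN1, add_zero]
    have e1 : ∫⁻ y, (1 - f s y) ∂π = ∫⁻ y in B, (1 - f s y) ∂π := by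
      rw [← lintegral_indicator hB]
      refine lintegral_congr_ae ?_
      filter_upwards [hN2'] with y hy
      by_cases h : f s y < 1
      · simp [B, h, hy]
      · simp [B, h, tsub_eq_zero_of_le (not_lt.1 h)]
    have e2 : ∫⁻ y in B, (1 - f s y) ∂π = π B - κ s B := by
      rw [lintegral_sub (hfs s) (hκB ▸ measure_ne_top _ _), hκB]
      · simp
      · filter_upwards [ae_restrict_mem hB] with y hy using hy.1.le
    simp only [e1, e2]
    refine ENNReal.le_ofReal_iff_toReal_le (by finiteness) (tvDist_nonneg _ _) |>.2 ?_
    have hle : κ s B ≤ π B := by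
      rw [hκB]
      calc ∫⁻ y in B, f s y ∂π ≤ ∫⁻ y in B, 1 ∂π :=
            setLIntegral_mono measurable_const fun y hy => hy.1.le
        _ = π B := by simp
    rw [ENNReal.toReal_sub_of_le hle (measure_ne_top _ _)]
    refine le_trans ?_ (le_tvDist (κ s) π hB)
    rw [abs_sub_comm]
    exact le_abs_self _
  · calc π A = ∫⁻ y in A, 1 ∂π := by simp
      _ ≤ ∫⁻ y in A, (f s y + (1 - f s y)) ∂π := lintegral_mono fun y => le_add_tsub
      _ = ∫⁻ y in A, f s y ∂π + ∫⁻ y in A, (1 - f s y) ∂π := lintegral_add_left (hfs s) _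
      _ ≤ κ s A + ∫⁻ y, (1 - f s y) ∂π := by
        gcongr
        · rw [← withDensity_apply _ hA, ← hκ s]
          exact Measure.le_add_right le_rfl A
        · exact Measure.restrict_le_self

/-- Mixtures of laws that converge in total variation converge in total variation. -/
theorem tendsto_tvDist_bind {μ : Measure E} [IsProbabilityMeasure μ] (κ : ℕ → Kernel E S)
    [∀ n, IsMarkovKernel (κ n)]
    (h : ∀ᵐ s ∂μ, Tendsto (fun n => tvDist (κ n s) π) atTop (𝓝 0)) :
    Tendsto (fun n => tvDist (μ.bind (κ n)) π) atTop (𝓝 0) := by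
  choose D hDm hD1 hDle hDA using fun n => exists_measurable_le_tvDist (π := π) (κ n)
  have hD : Tendsto (fun n => ∫⁻ s, D n s ∂μ) atTop (𝓝 0) := by
    have := tendsto_lintegral_of_dominated_convergence (μ := μ) (F := D) (f := fun _ => 0)
      (fun _ => 1) hDm (fun n => ae_of_all _ (hD1 n)) (by simp) (by
        filter_upwards [h] with s hs
        have hs' := ENNReal.tendsto_ofReal hs
        rw [ENNReal.ofReal_zero] at hs'
        exact tendsto_of_tendsto_of_tendsto_of_le_of_le tendsto_const_nhds hs'
          (fun _ => zero_le) fun n => hDle n s)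
    simpa using this
  have hfin : ∀ n, ∫⁻ s, D n s ∂μ ≠ ⊤ := fun n =>
    ((lintegral_mono (hD1 n)).trans_lt (by simp)).ne
  refine squeeze_zero (fun _ => tvDist_nonneg _ _) (fun n => ?_)
    (by simpa using (ENNReal.tendsto_toReal ENNReal.zero_ne_top).comp hD)
  have hbind : ∀ A, MeasurableSet A → π.real A - (μ.bind (κ n)).real A ≤ (∫⁻ s, D n s ∂μ).toReal := by
    intro A hA
    have h1 : π A ≤ (μ.bind (κ n)) A + ∫⁻ s, D n s ∂μ := by
      rw [Measure.bind_apply hA (κ n).aemeasurable, ← lintegral_add_right _ (hDm n)]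
      calc π A = ∫⁻ _, π A ∂μ := by simp
        _ ≤ _ := lintegral_mono fun s => hDA n s A hA
    have h2 := ENNReal.toReal_mono (by finiteness [hfin n]) h1
    rw [ENNReal.toReal_add (by finiteness) (hfin n)] at h2
    simp only [Measure.real]
    linarith
  refine tvDist_le fun A hA => abs_le.2 ⟨?_, ?_⟩
  · have := hbind A hA
    simp only [Function.comp_apply]
    linarith
  -- For probability measures, the lower bound on `Aᶜ` is the upper bound on `A`.
  · have := hbind Aᶜ hA.compl
    rw [probReal_compl_eq_one_sub hA, probReal_compl_eq_one_sub hA] at this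
    simp only [Function.comp_apply]
    linarith

end Mixture

/-! ### Measurable dependence on parameters -/

section Parameters

variable {E T S : Type*} [MeasurableSpace E] [MeasurableSpace T] [MeasurableSpace S]

lemma measurable_bind_param {κ : E → Measure T} (hκ : Measurable κ)
    [∀ s, IsProbabilityMeasure (κ s)] {g : E → T → Measure S}
    (hg : Measurable (Function.uncurry g)) : Measurable fun s => (κ s).bind (g s) := by
  refine Measure.measurable_of_measurable_coe _ fun A hA => ?_
  have e : ∀ s, (κ s).bind (g s) A = ∫⁻ y, g s y A ∂κ s := fun s =>
    Measure.bind_apply hA (hg.comp measurable_prodMk_left).aemeasurable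
  simp only [e]
  let k : Kernel E T := ⟨κ, hκ⟩
  have : IsMarkovKernel k := ⟨fun s => inferInstanceAs (IsProbabilityMeasure (κ s))⟩
  exact Measurable.lintegral_kernel_prod_right (κ := k) ((Measure.measurable_coe hA).comp hg)

lemma isProbabilityMeasure_bind {μ : Measure T} [IsProbabilityMeasure μ] {g : T → Measure S}
    (hg : Measurable g) (h : ∀ y, IsProbabilityMeasure (g y)) : IsProbabilityMeasure (μ.bind g) := by
  constructor
  rw [Measure.bind_apply .univ hg.aemeasurable]
  simp

lemma acceptReject_apply (a : ℝ) (y' y : S) {A : Set S} (hA : MeasurableSet A) :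
    acceptReject a y' y A = ENNReal.ofReal a * A.indicator 1 y'
      + ENNReal.ofReal (1 - a) * A.indicator 1 y := by
  simp [acceptReject, Measure.dirac_apply' _ hA]

lemma isProbabilityMeasure_acceptReject {a : ℝ} (h0 : 0 ≤ a) (h1 : a ≤ 1) (y' y : S) :
    IsProbabilityMeasure (acceptReject a y' y) := by
  constructor
  rw [acceptReject_apply _ _ _ .univ]
  simp [← ENNReal.ofReal_add h0 (sub_nonneg.2 h1)]

lemma measurable_acceptReject {a : E → ℝ} (ha : Measurable a) {y' y : E → S} (hy' : Measurable y')
    (hy : Measurable y) : Measurable fun s => acceptReject (a s) (y' s) (y s) := by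
  refine Measure.measurable_of_measurable_coe _ fun A hA => ?_
  simp only [acceptReject_apply _ _ _ hA]
  have h : Measurable (A.indicator (1 : S → ENNReal)) := measurable_one.indicator hA
  exact (ha.ennreal_ofReal.mul (h.comp hy')).add
    ((measurable_const.sub ha).ennreal_ofReal.mul (h.comp hy))

/-- The parameter in `E` will be the reduced basis, over whose random value laws are integrated; a
one-point `E` gives the fixed-model case. The two claims share one induction because the mass of a
bind is computed from measurability of the integrand. -/
lemma isProbabilityMeasure_and_measurable_subchain {K : E → S → Measure S}
    (hK : Measurable (Function.uncurry K)) (hK1 : ∀ s y, IsProbabilityMeasure (K s y))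
    {brk : E → Set S} (hbrk : MeasurableSet {s : E × S | s.2 ∈ brk s.1}) (i : ℕ) :
    (Measurable fun s : E × S => subchain (K s.1) (brk s.1) i s.2) ∧
      ∀ s y, IsProbabilityMeasure (subchain (K s) (brk s) i y) := by
  classical
  induction i with
  | zero => exact ⟨Measure.measurable_dirac.comp measurable_snd,
      fun s y => Measure.dirac.isProbabilityMeasure⟩
  | succ i ih =>
    have hg : Measurable fun s : (E × S) × S =>
        if s.2 ∈ brk s.1.1 then Measure.dirac s.2 else subchain (K s.1.1) (brk s.1.1) i s.2 := by
      have hm : Measurable fun s : (E × S) × S => (s.1.1, s.2) := by fun_prop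
      exact Measurable.ite (hm hbrk) (Measure.measurable_dirac.comp measurable_snd) (ih.1.comp hm)
    have : ∀ s : E × S, IsProbabilityMeasure (Function.uncurry K s) := fun s => hK1 _ _
    constructor
    · exact measurable_bind_param hK (g := fun (s : E × S) y' =>
        if y' ∈ brk s.1 then Measure.dirac y' else subchain (K s.1) (brk s.1) i y') hg
    · intro s y
      have := hK1 s y
      refine isProbabilityMeasure_bind ?_ fun y' => ?_
      · exact hg.comp (measurable_prodMk_left (x := (s, y)))
      · by_cases h : y' ∈ brk s
        · simp only [h, if_true]; exact Measure.dirac.isProbabilityMeasure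
        · simp only [h, if_false]; exact ih.2 s y'

lemma subchain_empty (K : S → Measure S) (i : ℕ) : subchain K ∅ i = nStep K i := by
  induction i with
  | zero => rfl
  | succ i ih => funext y; simp [subchain, nStep, ih]

lemma NullAvoiding.subchain {μ : Measure S} {K : S → Measure S} (hK : Measurable K)
    (hK1 : ∀ y, IsProbabilityMeasure (K y)) (h : NullAvoiding μ K) {brk : Set S}
    (hbrk : MeasurableSet brk) (i : ℕ) : NullAvoiding μ (DelayedAcceptance.subchain K brk i) := by
  classical
  induction i with
  | zero =>
    intro x B hB _ hx
    simp [DelayedAcceptance.subchain, Measure.dirac_apply' _ hB, hx]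
  | succ i ih =>
    intro x B hB hμ hx
    have hm := (isProbabilityMeasure_and_measurable_subchain (E := Unit) (K := fun _ => K)
      (hK.comp measurable_snd) (fun _ => hK1) (brk := fun _ => brk) (measurable_snd hbrk) i).1.comp
      (measurable_prodMk_left (x := ()))
    have hae : ∀ᵐ y ∂K x, y ∉ B := measure_eq_zero_iff_ae_notMem.1 (h x B hB hμ hx)
    refine bind_apply_eq_zero ?_ hB ?_
    · exact Measurable.ite (p := fun y => y ∈ brk) hbrk Measure.measurable_dirac hm
    · filter_upwards [hae] with y hy
      by_cases hyb : y ∈ brk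
      · simp [hyb, Measure.dirac_apply' _ hB, hy]
      · simpa [hyb] using ih y B hB hμ hy

lemma NullAvoiding.bind_acceptReject {μ : Measure S} {κ : S → Measure S} (h : NullAvoiding μ κ)
    {a : S → S → ℝ} (ha : Measurable (Function.uncurry a)) :
    NullAvoiding μ fun x => (κ x).bind fun y => acceptReject (a x y) y x := by
  intro x B hB hμ hx
  have hae : ∀ᵐ y ∂κ x, y ∉ B := measure_eq_zero_iff_ae_notMem.1 (h x B hB hμ hx)
  refine bind_apply_eq_zero (measurable_acceptReject (ha.comp measurable_prodMk_left)
    measurable_id measurable_const) hB ?_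
  filter_upwards [hae] with y hy
  simp [acceptReject_apply _ _ _ hB, hy, hx]

end Parameters

/-! ### Detailed balance -/

section DetailedBalance

variable {S : Type*} [MeasurableSpace S] {μ : Measure S}

/-- The rejected mass sits on the diagonal and contributes the integral of `r` over `A ∩ B`, which
is symmetric; only the flow of accepted moves has to be balanced. Both acceptance stages have this
form. -/
lemma detailedBalance_bind_acceptReject {κ : S → Measure S} (hκ : Measurable κ)
    [∀ x, IsProbabilityMeasure (κ x)] {a : S → S → ℝ} (ha : Measurable (Function.uncurry a))
    (hsymm : ∀ A B, MeasurableSet A → MeasurableSet B →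
      ∫⁻ x in A, ∫⁻ y in B, ENNReal.ofReal (a x y) ∂κ x ∂μ
        = ∫⁻ x in B, ∫⁻ y in A, ENNReal.ofReal (a x y) ∂κ x ∂μ) :
    DetailedBalance μ fun x => (κ x).bind fun y => acceptReject (a x y) y x := by
  let k : Kernel S S := ⟨κ, hκ⟩
  have : IsMarkovKernel k := ⟨fun s => inferInstanceAs (IsProbabilityMeasure (κ s))⟩
  have hx : ∀ x, Measurable (a x) := fun x => ha.comp measurable_prodMk_left
  set r : S → ENNReal := fun x => ∫⁻ y, ENNReal.ofReal (1 - a x y) ∂κ x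
  have hr : Measurable r := Measurable.lintegral_kernel_prod_right (κ := k)
    (f := fun x y => ENNReal.ofReal (1 - a x y)) (measurable_const.sub ha).ennreal_ofReal
  have e : ∀ x B, MeasurableSet B → ((κ x).bind fun y => acceptReject (a x y) y x) B
      = ∫⁻ y in B, ENNReal.ofReal (a x y) ∂κ x + B.indicator r x := by
    intro x B hB
    have hm : Measurable fun y => acceptReject (a x y) y x :=
      measurable_acceptReject (hx x) measurable_id measurable_const
    rw [Measure.bind_apply hB hm.aemeasurable]
    simp only [acceptReject_apply _ _ _ hB]
    rw [lintegral_add_left (f := fun y => ENNReal.ofReal (a x y) * B.indicator 1 y)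
        ((hx x).ennreal_ofReal.mul (measurable_one.indicator hB)),
      lintegral_mul_const (f := fun y => ENNReal.ofReal (1 - a x y)) _
        (measurable_const.sub (hx x)).ennreal_ofReal, ← lintegral_indicator hB]
    congr 1
    · refine lintegral_congr fun y => ?_
      by_cases h : y ∈ B <;> simp [h]
    · by_cases h : x ∈ B <;> simp [h, r]
  intro A B hA hB
  simp only [e _ _ hA, e _ _ hB]
  rw [lintegral_add_right _ (hr.indicator hB), lintegral_add_right _ (hr.indicator hA),
    hsymm A B hA hB, lintegral_indicator hB, lintegral_indicator hA, Measure.restrict_restrict hB,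
    Measure.restrict_restrict hA, Set.inter_comm]

variable [IsFiniteMeasure μ] {κ : Kernel S S} [IsMarkovKernel κ]

lemma setLIntegral_setLIntegral_swap (hrev : DetailedBalance μ κ) {h : S → S → ENNReal}
    (hh : Measurable (Function.uncurry h)) {A B : Set S} (hA : MeasurableSet A)
    (hB : MeasurableSet B) :
    ∫⁻ x in A, ∫⁻ y in B, h x y ∂κ x ∂μ = ∫⁻ x in B, ∫⁻ y in A, h y x ∂κ x ∂μ := by
  refine (Measure.setLIntegral_compProd (f := Function.uncurry h) hh hA hB).symm.trans
    (Eq.trans ?_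
      (Measure.setLIntegral_compProd (f := fun s => h s.2 s.1) (hh.comp measurable_swap) hB hA))
  conv_lhs => rw [← compProd_map_swap hrev]
  rw [setLIntegral_map (hA.prod hB) hh measurable_swap, Set.preimage_swap_prod]
  rfl

/-- Split off the first step on one side and the last step on the other. Reversing `κ` in one and
`nStep κ n` in the other turns both into `∫ κ y A * nStep κ n y B ∂μ`. -/
lemma detailedBalance_nStep (hrev : DetailedBalance μ κ) (n : ℕ) :
    DetailedBalance μ (nStep κ n) := by
  induction n with
  | zero =>
    intro A B hA hB
    simp only [nStep, Measure.dirac_apply' _ hA, Measure.dirac_apply' _ hB]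
    rw [lintegral_indicator hB, lintegral_indicator hA, Measure.restrict_restrict hB,
      Measure.restrict_restrict hA, Set.inter_comm]
  | succ n ih =>
    intro A B hA hB
    let η : Kernel S S := ⟨nStep κ n, measurable_nStep κ.measurable n⟩
    have : IsMarkovKernel η := ⟨fun x => inferInstanceAs (IsProbabilityMeasure (nStep κ n x))⟩
    have hη : ∀ C, MeasurableSet C → Measurable fun x => nStep κ n x C := fun C hC =>
      (Measure.measurable_coe hC).comp (measurable_nStep κ.measurable n)
    have hκ : ∀ C, MeasurableSet C → Measurable fun x => κ x C := fun C hC =>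
      (Measure.measurable_coe hC).comp κ.measurable
    have h1 := setLIntegral_setLIntegral_swap hrev (h := fun _ y => nStep κ n y B)
      ((hη B hB).comp measurable_snd) hA .univ
    have h2 := setLIntegral_setLIntegral_swap (κ := η) ih (h := fun _ y => κ y A)
      ((hκ A hA).comp measurable_snd) hB .univ
    have e2 : ∀ x, nStep κ (n + 1) x A = ∫⁻ y, κ y A ∂nStep κ n x := fun x => by
      rw [nStep_add κ.measurable, Measure.bind_apply hA
        (measurable_nStep κ.measurable 1).aemeasurable]
      simp only [nStep_one]
    simp only [nStep_apply_succ κ.measurable n _ hB, e2]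
    simp only [Measure.restrict_univ, lintegral_const, Measure.restrict_apply, MeasurableSet.univ,
      Set.univ_inter] at h1 h2
    rw [h1]
    change _ = ∫⁻ x in B, ∫⁻ y, κ y A ∂η x ∂μ
    rw [h2]
    exact lintegral_congr fun x => mul_comm _ _

end DetailedBalance

/-! ### The two acceptance stages -/

section Stages

variable {S : Type*} [MeasureSpace S] [SFinite (volume : Measure S)]

/-- A measurable family of probability densities. -/
structure IsProposal (q : S → S → ℝ) : Prop where
  meas : Measurable (Function.uncurry q)
  nonneg : ∀ x y, 0 ≤ q x y
  prob : ∀ x, IsProbabilityMeasure (densityMeasure (q x))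

/-- Nonnegative measurable functions that are positive at the same points. -/
structure SamePositivity (p pm : S → ℝ) : Prop where
  meas_left : Measurable p
  meas_right : Measurable pm
  nonneg_left : ∀ x, 0 ≤ p x
  nonneg_right : ∀ x, 0 ≤ pm x
  pos_iff : ∀ x, 0 < p x ↔ 0 < pm x

lemma measurable_densityMeasure {E : Type*} [MeasurableSpace E] {f : E → S → ℝ}
    (hf : Measurable (Function.uncurry f)) : Measurable fun s => densityMeasure (f s) := by
  refine Measure.measurable_of_measurable_coe _ fun A hA => ?_
  simp only [densityMeasure, withDensity_apply _ hA]
  exact hf.ennreal_ofReal.lintegral_prod_right'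

omit [SFinite (volume : Measure S)] in
lemma densityMeasure_eq_zero_iff {p : S → ℝ} (hp : Measurable p) {A : Set S} :
    densityMeasure p A = 0 ↔ volume ({x | 0 < p x} ∩ A) = 0 := by
  rw [densityMeasure, withDensity_apply_eq_zero hp.ennreal_ofReal]
  simp

omit [SFinite (volume : Measure S)] in
lemma setLIntegral_densityMeasure {p : S → ℝ} (hp : Measurable p) {g : S → ENNReal}
    (hg : Measurable g) {A : Set S} (hA : MeasurableSet A) :
    ∫⁻ x in A, g x ∂densityMeasure p = ∫⁻ x in A, ENNReal.ofReal (p x) * g x :=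
  setLIntegral_withDensity_eq_setLIntegral_mul _ hp.ennreal_ofReal hg hA

omit [SFinite (volume : Measure S)] in
lemma ae_densityMeasure_pos {p : S → ℝ} (hp : Measurable p) : ∀ᵐ x ∂densityMeasure p, 0 < p x := by
  rw [ae_iff, densityMeasure_eq_zero_iff hp]
  convert measure_empty (μ := (volume : Measure S))
  ext x; simp

section Measurability

variable {E : Type*} [MeasurableSpace E] {p : S → ℝ} {pm : E → S → ℝ} {q : S → S → ℝ}

omit [SFinite (volume : Measure S)] in
lemma measurable_firstAccept (hpm : Measurable (Function.uncurry pm)) (hq : IsProposal q) :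
    Measurable fun s : (E × S) × S => firstAccept (pm s.1.1) q s.1.2 s.2 := by
  have h1 : Measurable fun s : (E × S) × S => pm s.1.1 s.2 :=
    hpm.comp (f := fun s : (E × S) × S => (s.1.1, s.2)) (by fun_prop)
  have h2 : Measurable fun s : (E × S) × S => pm s.1.1 s.1.2 := hpm.comp measurable_fst
  have h3 : Measurable fun s : (E × S) × S => q s.2 s.1.2 :=
    hq.meas.comp (f := fun s : (E × S) × S => (s.2, s.1.2)) (by fun_prop)
  have h4 : Measurable fun s : (E × S) × S => q s.1.2 s.2 :=
    hq.meas.comp (f := fun s : (E × S) × S => (s.1.2, s.2)) (by fun_prop)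
  exact measurable_const.min ((h1.div h2).mul (h3.div h4))

omit [SFinite (volume : Measure S)] in
lemma measurable_secondAccept (hp : Measurable p) (hpm : Measurable (Function.uncurry pm)) :
    Measurable fun s : (E × S) × S => secondAccept p (pm s.1.1) s.1.2 s.2 := by
  have h1 : Measurable fun s : (E × S) × S => pm s.1.1 s.2 :=
    hpm.comp (f := fun s : (E × S) × S => (s.1.1, s.2)) (by fun_prop)
  have h2 : Measurable fun s : (E × S) × S => pm s.1.1 s.1.2 := hpm.comp measurable_fst
  have h3 : Measurable fun s : (E × S) × S => p s.2 := hp.comp measurable_snd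
  have h4 : Measurable fun s : (E × S) × S => p s.1.2 := hp.comp (measurable_snd.comp measurable_fst)
  exact measurable_const.min ((h3.div h4).mul (h2.div h1))

omit [MeasureSpace S] [SFinite (volume : Measure S)] in
lemma firstAccept_nonneg {pm : S → ℝ} (h : ∀ x, 0 ≤ pm x) (hq : ∀ x y, 0 ≤ q x y) (y y' : S) :
    0 ≤ firstAccept pm q y y' :=
  le_min zero_le_one (mul_nonneg (div_nonneg (h _) (h _)) (div_nonneg (hq _ _) (hq _ _)))

omit [MeasureSpace S] [SFinite (volume : Measure S)] in
lemma secondAccept_nonneg {pm : S → ℝ} (hp : ∀ x, 0 ≤ p x) (h : ∀ x, 0 ≤ pm x) (y y' : S) :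
    0 ≤ secondAccept p pm y y' :=
  le_min zero_le_one (mul_nonneg (div_nonneg (hp _) (hp _)) (div_nonneg (h _) (h _)))

lemma measurable_firstStageStep (hpm : Measurable (Function.uncurry pm)) (hq : IsProposal q) :
    Measurable (Function.uncurry fun s => firstStageStep (pm s) q) := by
  have := hq.prob
  refine measurable_bind_param (κ := fun s : E × S => densityMeasure (q s.2))
    ((measurable_densityMeasure hq.meas).comp measurable_snd)
    (g := fun s y' => acceptReject (firstAccept (pm s.1) q s.2 y') y' s.2) ?_
  exact measurable_acceptReject (measurable_firstAccept hpm hq) measurable_snd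
    (measurable_snd.comp measurable_fst)

omit [SFinite (volume : Measure S)] in
lemma isProbabilityMeasure_firstStageStep {pm : S → ℝ} (hpm : Measurable pm)
    (h : ∀ x, 0 ≤ pm x) (hq : IsProposal q) (y : S) :
    IsProbabilityMeasure (firstStageStep pm q y) := by
  have := hq.prob y
  refine isProbabilityMeasure_bind ?_ fun y' => isProbabilityMeasure_acceptReject
    (firstAccept_nonneg h hq.nonneg _ _) (min_le_left _ _) _ _
  exact measurable_acceptReject ((measurable_firstAccept (E := Unit) (pm := fun _ => pm)
    (hpm.comp measurable_snd) hq).comp (measurable_prodMk_left (x := ((), y)))) measurable_id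
    measurable_const

lemma measurable_subchain_firstStage (hpm : Measurable (Function.uncurry pm))
    (h0 : ∀ s x, 0 ≤ pm s x) (hq : IsProposal q) {brk : E → Set S}
    (hbrk : MeasurableSet {s : E × S | s.2 ∈ brk s.1}) (L : ℕ) :
    Measurable fun s : E × S => subchain (firstStageStep (pm s.1) q) (brk s.1) L s.2 :=
  (isProbabilityMeasure_and_measurable_subchain (measurable_firstStageStep hpm hq)
    (fun s => isProbabilityMeasure_firstStageStep (hpm.comp measurable_prodMk_left) (h0 s) hq)
    hbrk L).1

lemma isProbabilityMeasure_subchain_firstStage (hpm : Measurable (Function.uncurry pm))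
    (h0 : ∀ s x, 0 ≤ pm s x) (hq : IsProposal q) {brk : E → Set S}
    (hbrk : MeasurableSet {s : E × S | s.2 ∈ brk s.1}) (L : ℕ) (s : E) (x : S) :
    IsProbabilityMeasure (subchain (firstStageStep (pm s) q) (brk s) L x) :=
  (isProbabilityMeasure_and_measurable_subchain (measurable_firstStageStep hpm hq)
    (fun s => isProbabilityMeasure_firstStageStep (hpm.comp measurable_prodMk_left) (h0 s) hq)
    hbrk L).2 s x

lemma measurable_delayedStep (hp : Measurable p) (hpm : Measurable (Function.uncurry pm))
    (h0 : ∀ s x, 0 ≤ pm s x) (hq : IsProposal q) (L : ℕ) :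
    Measurable fun s : E × S => delayedStep p (pm s.1) q L s.2 := by
  have hbrk : MeasurableSet {s : E × S | s.2 ∈ (fun _ : E => (∅ : Set S)) s.1} := by simp
  have h1 : ∀ s : E × S, IsProbabilityMeasure
      (subchain (firstStageStep (pm s.1) q) ∅ L s.2) := fun s =>
    isProbabilityMeasure_subchain_firstStage (brk := fun _ => ∅) hpm h0 hq hbrk L s.1 s.2
  refine measurable_bind_param (measurable_subchain_firstStage (brk := fun _ => ∅) hpm h0 hq hbrk L)
    (g := fun s x' => acceptReject (secondAccept p (pm s.1) s.2 x') x' s.2) ?_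
  exact measurable_acceptReject (measurable_secondAccept hp hpm) measurable_snd
    (measurable_snd.comp measurable_fst)

end Measurability

variable {p pm : S → ℝ} {q : S → S → ℝ}

lemma measurable_firstStageStep_const (hpm : Measurable pm) (hq : IsProposal q) :
    Measurable (firstStageStep pm q) := by
  have h : Measurable (Function.uncurry fun _ : Unit => firstStageStep pm q) :=
    measurable_firstStageStep (pm := fun _ => pm) (hpm.comp measurable_snd) hq
  have h' := h.comp (measurable_prodMk_left (x := ()))
  exact h'

/-- The first stage as a kernel. -/
def firstStageKernel (hpm : Measurable pm) (hq : IsProposal q) : Kernel S S :=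
  ⟨firstStageStep pm q, measurable_firstStageStep_const hpm hq⟩

lemma measurable_delayedStep_const (h : SamePositivity p pm) (hq : IsProposal q) (L : ℕ) :
    Measurable (delayedStep p pm q L) := by
  have h : Measurable (Function.uncurry fun _ : Unit => delayedStep p pm q L) :=
    measurable_delayedStep (pm := fun _ => pm) h.meas_left
      (h.meas_right.comp measurable_snd) (fun _ => h.nonneg_right) hq L
  have h' := h.comp (measurable_prodMk_left (x := ()))
  exact h'

omit [SFinite (volume : Measure S)] in
lemma measurable_secondAccept_const (h : SamePositivity p pm) :
    Measurable (Function.uncurry (secondAccept p pm)) :=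
  (measurable_secondAccept (E := Unit) (pm := fun _ => pm) h.meas_left
    (h.meas_right.comp measurable_snd)).comp
    (f := fun s : S × S => (((), s.1), s.2)) (by fun_prop)

omit [SFinite (volume : Measure S)] in
lemma measurable_firstAccept_const (hpm : Measurable pm) (hq : IsProposal q) :
    Measurable (Function.uncurry (firstAccept pm q)) :=
  (measurable_firstAccept (E := Unit) (pm := fun _ => pm) (hpm.comp measurable_snd) hq).comp
    (f := fun s : S × S => (((), s.1), s.2)) (by fun_prop)

lemma isProbabilityMeasure_delayedStep (h : SamePositivity p pm) (hq : IsProposal q) (L : ℕ)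
    (x : S) : IsProbabilityMeasure (delayedStep p pm q L x) := by
  have := isProbabilityMeasure_subchain_firstStage (E := Unit) (pm := fun _ => pm)
    (h.meas_right.comp measurable_snd) (fun _ => h.nonneg_right) hq (brk := fun _ => ∅) (by simp)
    L () x
  exact isProbabilityMeasure_bind (measurable_acceptReject
    ((measurable_secondAccept_const h).comp measurable_prodMk_left) measurable_id measurable_const)
    fun y' => isProbabilityMeasure_acceptReject
    (secondAccept_nonneg h.nonneg_left h.nonneg_right _ _) (min_le_left _ _) _ _

/-- One step of the delayed acceptance chain as a kernel. -/
def delayedKernel (h : SamePositivity p pm) (hq : IsProposal q) (L : ℕ) : Kernel S S :=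
  ⟨delayedStep p pm q L, measurable_delayedStep_const h hq L⟩

lemma isMarkovKernel_firstStageKernel (h : SamePositivity p pm) (hq : IsProposal q) :
    IsMarkovKernel (firstStageKernel h.meas_right hq) :=
  ⟨isProbabilityMeasure_firstStageStep h.meas_right h.nonneg_right hq⟩

lemma isMarkovKernel_delayedKernel (h : SamePositivity p pm) (hq : IsProposal q) (L : ℕ) :
    IsMarkovKernel (delayedKernel h hq L) :=
  ⟨isProbabilityMeasure_delayedStep h hq L⟩

/-! ### Detailed balance of the stages -/

-- The Metropolis-Hastings flow density is symmetric in `x` and `y`. If `pm x` or `q x y` vanishes,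
-- that factor annihilates whatever value the quotient takes.
omit [MeasureSpace S] [SFinite (volume : Measure S)] in
lemma mul_firstAccept (hpm : ∀ x, 0 ≤ pm x) (hq : ∀ x y, 0 ≤ q x y) (x y : S) :
    pm x * (q x y * firstAccept pm q x y) = min (pm x * q x y) (pm y * q y x) := by
  rcases (hpm x).eq_or_lt with h | h
  · simp [← h, mul_nonneg (hpm y) (hq y x)]
  rcases (hq x y).eq_or_lt with h' | h'
  · simp [← h', mul_nonneg (hpm y) (hq y x)]
  rw [firstAccept, ← mul_assoc, mul_min_of_nonneg _ _ (by positivity), mul_one]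
  congr 1
  field_simp

-- The subchain is reversible for the approximate posterior, so only the ratio `p / pm` of the two
-- densities enters the second-stage flow, again as a symmetric minimum.
omit [MeasureSpace S] [SFinite (volume : Measure S)] in
lemma mul_secondAccept {x y : S} (hp : 0 ≤ p y) (hr : 0 ≤ pm y)
    (hx : 0 < p x ↔ 0 < pm x) (hr' : 0 ≤ pm x) :
    p x / pm x * secondAccept p pm x y = min (p x / pm x) (p y / pm y) := by
  rcases hr'.eq_or_lt with h | h
  · simp [← h, div_nonneg hp hr]
  have h' := hx.2 h
  rw [secondAccept, mul_min_of_nonneg _ _ (by positivity), mul_one]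
  congr 1
  field_simp

lemma detailedBalance_firstStageStep (hpm : Measurable pm) (h0 : ∀ x, 0 ≤ pm x)
    (hq : IsProposal q) : DetailedBalance (densityMeasure pm) (firstStageStep pm q) := by
  have := hq.prob
  have hα := measurable_firstAccept_const hpm hq
  have hpx : ∀ x, Measurable (q x) := fun x => hq.meas.comp measurable_prodMk_left
  refine detailedBalance_bind_acceptReject (measurable_densityMeasure hq.meas) hα fun A B hA hB => ?_
  set m : S → S → ℝ := fun x y => min (pm x * q x y) (pm y * q y x)
  have hm : Measurable (Function.uncurry m) :=
    ((hpm.comp measurable_fst).mul hq.meas).min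
      ((hpm.comp measurable_snd).mul (hq.meas.comp measurable_swap))
  have key : ∀ A B, MeasurableSet A → MeasurableSet B →
      ∫⁻ x in A, ∫⁻ y in B, ENNReal.ofReal (firstAccept pm q x y) ∂densityMeasure (q x)
        ∂densityMeasure pm = ∫⁻ x in A, ∫⁻ y in B, ENNReal.ofReal (m x y) := by
    intro A B hA hB
    have e1 : ∀ x, ∫⁻ y in B, ENNReal.ofReal (firstAccept pm q x y) ∂densityMeasure (q x)
        = ∫⁻ y in B, ENNReal.ofReal (q x y * firstAccept pm q x y) := fun x => by
      rw [setLIntegral_densityMeasure (g := fun y => ENNReal.ofReal (firstAccept pm q x y)) (hpx x)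
        (hα.comp measurable_prodMk_left).ennreal_ofReal hB]
      exact lintegral_congr fun y => (ENNReal.ofReal_mul (hq.nonneg x y)).symm
    simp only [e1]
    have hm2 : Measurable (Function.uncurry fun x y => ENNReal.ofReal (q x y * firstAccept pm q x y)) :=
      (hq.meas.mul hα).ennreal_ofReal
    rw [setLIntegral_densityMeasure
      (g := fun x => ∫⁻ y in B, ENNReal.ofReal (q x y * firstAccept pm q x y)) hpm
      hm2.lintegral_prod_right' hA]
    refine lintegral_congr fun x => ?_
    rw [← lintegral_const_mul (f := fun y => ENNReal.ofReal (q x y * firstAccept pm q x y)) _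
      (hm2.comp measurable_prodMk_left)]
    refine lintegral_congr fun y => ?_
    rw [← ENNReal.ofReal_mul (h0 x), mul_firstAccept h0 hq.nonneg]
  rw [key A B hA hB, key B A hB hA]
  rw [lintegral_lintegral_swap (f := fun x y => ENNReal.ofReal (m x y))
    hm.ennreal_ofReal.aemeasurable]
  simp only [m, min_comm]

/-- Write `p = pm * r`. The accepted flow is `min (r x) (r y)` times the joint law of the ends of
the subchain started from `pm`: a symmetric function times a symmetric measure. -/
lemma detailedBalance_delayedStep [IsFiniteMeasure (densityMeasure pm)] (h : SamePositivity p pm)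
    (hq : IsProposal q) (L : ℕ) : DetailedBalance (densityMeasure p) (delayedStep p pm q L) := by
  have := isMarkovKernel_firstStageKernel h hq
  set κ := firstStageKernel h.meas_right hq
  have hbal : DetailedBalance (densityMeasure pm) (nStep κ L) :=
    detailedBalance_nStep (detailedBalance_firstStageStep h.meas_right h.nonneg_right hq) L
  let η : Kernel S S := ⟨nStep κ L, measurable_nStep κ.measurable L⟩
  have : IsMarkovKernel η := ⟨fun x => inferInstanceAs (IsProbabilityMeasure (nStep κ L x))⟩
  have hβ := measurable_secondAccept_const h
  set r : S → ℝ := fun x => p x / pm x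
  have hr : Measurable r := h.meas_left.div h.meas_right
  have hr0 : ∀ x, 0 ≤ r x := fun x => div_nonneg (h.nonneg_left x) (h.nonneg_right x)
  -- Where `pm` vanishes so does `p`, and the identity survives division by zero.
  have hpr : ∀ x, p x = pm x * r x := fun x => by
    rcases (h.nonneg_right x).eq_or_lt with h0 | h0
    · have : ¬ 0 < p x := fun h' => ((h.pos_iff x).1 h').ne h0
      simp [← h0, le_antisymm (not_lt.1 this) (h.nonneg_left x)]
    · simp only [r]; field_simp
  have hm : Measurable (Function.uncurry fun x y => ENNReal.ofReal (min (r x) (r y))) :=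
    ((hr.comp measurable_fst).min (hr.comp measurable_snd)).ennreal_ofReal
  have e : delayedStep p pm q L
      = fun x => (nStep κ L x).bind fun y => acceptReject (secondAccept p pm x y) y x := by
    funext x
    rw [delayedStep, subchain_empty]
    rfl
  rw [e]
  refine detailedBalance_bind_acceptReject (measurable_nStep κ.measurable L) hβ fun A B hA hB => ?_
  have key : ∀ A B, MeasurableSet A → MeasurableSet B →
      ∫⁻ x in A, ∫⁻ y in B, ENNReal.ofReal (secondAccept p pm x y) ∂η x ∂densityMeasure p
        = ∫⁻ x in A, ∫⁻ y in B, ENNReal.ofReal (min (r x) (r y)) ∂η x ∂densityMeasure pm := by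
    intro A B hA hB
    have hI : ∀ {f : S → S → ENNReal}, Measurable (Function.uncurry f) →
        Measurable fun x => ∫⁻ y in B, f x y ∂η x := fun {f} hf => by
      simp only [← lintegral_indicator hB]
      refine Measurable.lintegral_kernel_prod_right (κ := η) (f := fun x => B.indicator (f x)) ?_
      have : (Function.uncurry fun x => B.indicator (f x))
          = (Prod.snd ⁻¹' B : Set (S × S)).indicator (Function.uncurry f) := by
        ext ⟨x, y⟩
        by_cases hy : y ∈ B <;> simp [Function.uncurry, hy]
      rw [this]
      exact hf.indicator (measurable_snd hB)
    rw [setLIntegral_densityMeasure h.meas_left (hI (f := fun x y =>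
        ENNReal.ofReal (secondAccept p pm x y)) hβ.ennreal_ofReal) hA,
      setLIntegral_densityMeasure h.meas_right (hI hm) hA]
    refine lintegral_congr fun x => ?_
    rw [hpr x, ENNReal.ofReal_mul (h.nonneg_right x), mul_assoc,
      ← lintegral_const_mul (f := fun y => ENNReal.ofReal (secondAccept p pm x y)) _
        (hβ.ennreal_ofReal.comp measurable_prodMk_left)]
    congr 1
    refine lintegral_congr fun y => ?_
    rw [← ENNReal.ofReal_mul (hr0 x), mul_secondAccept (h.nonneg_left y) (h.nonneg_right y)
      (h.pos_iff x) (h.nonneg_right x)]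
  change ∫⁻ x in A, ∫⁻ y in B, _ ∂η x ∂_ = ∫⁻ x in B, ∫⁻ y in A, _ ∂η x ∂_
  rw [key A B hA hB, key B A hB hA, setLIntegral_setLIntegral_swap (κ := η) hbal hm hA hB]
  simp only [min_comm]

end Stages

/-- Null avoidance keeps the chain in the full set `I` almost surely, so one-step positivity is
still available at the last step. -/
lemma nStep_succ_pos {S : Type*} [MeasurableSpace S] {κ : Kernel S S} [IsMarkovKernel κ]
    {μ : Measure S} (hnull : NullAvoiding μ κ) {I A : Set S} (hI : MeasurableSet I)
    (hμ : μ Iᶜ = 0) (hA : MeasurableSet A) (h : ∀ x ∈ I, 0 < κ x A) (n : ℕ) :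
    ∀ x ∈ I, 0 < nStep κ (n + 1) x A := by
  induction n with
  | zero => intro x hx; rw [Nat.zero_add, nStep_one]; exact h x hx
  | succ n ih =>
    intro x hx
    have hae : ∀ᵐ y ∂κ x, y ∈ I := mem_ae_iff.2 (hnull x _ hI.compl hμ fun h => h hx)
    exact bind_apply_pos (measurable_nStep κ.measurable (n + 1)) hA (C := Set.univ)
      (by simp) (hae.mono fun y hy _ => ih y hy)

/-! ### Positivity of the transition laws -/

section Positivity

variable {S : Type*} [MeasureSpace S] [SFinite (volume : Measure S)] {p pm : S → ℝ}
  {q : S → S → ℝ}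

/-- Points of positive density that can be proposed from almost every state. -/
def proposablePoints (p : S → ℝ) (q : S → S → ℝ) : Set S :=
  {x | 0 < p x ∧ ∀ᵐ y ∂densityMeasure p, 0 < q y x}

-- The zero set of `q x` has no mass under `q x`, so irreducibility forbids it positive posterior
-- probability.
omit [SFinite (volume : Measure S)] in
lemma ae_proposal_pos (hq : IsProposal q) (hirr : IrreducibleProposal p q) {x : S}
    (hx : 0 < p x) : ∀ᵐ y ∂densityMeasure p, 0 < q x y := by
  have hqx : Measurable (q x) := hq.meas.comp measurable_prodMk_left
  have hA : MeasurableSet {y | ¬ 0 < q x y} := (measurableSet_lt measurable_const hqx).compl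
  rw [ae_iff]
  by_contra hne
  exact (hirr x hx _ hA (pos_iff_ne_zero.2 hne)).ne' (ae_iff.1 (ae_densityMeasure_pos hqx))

omit [SFinite (volume : Measure S)] in
lemma measurableSet_proposablePoints [IsProbabilityMeasure (densityMeasure p)] (hp : Measurable p)
    (hq : IsProposal q) : MeasurableSet (proposablePoints p q) := by
  have hs : MeasurableSet {s : S × S | ¬ 0 < q s.2 s.1} :=
    (measurableSet_lt measurable_const (hq.meas.comp measurable_swap)).compl
  refine (measurableSet_lt measurable_const hp).inter ?_
  exact (measurable_measure_prodMk_left (ν := densityMeasure p) hs) (measurableSet_singleton 0)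

omit [SFinite (volume : Measure S)] in
lemma measurableSet_startingPoints [IsProbabilityMeasure (densityMeasure p)] (hp : Measurable p)
    (hq : IsProposal q) : MeasurableSet (startingPoints p q) := by
  have hs : MeasurableSet {s : S × S | 0 < q s.2 s.1} :=
    measurableSet_lt measurable_const (hq.meas.comp measurable_swap)
  refine (measurableSet_lt measurable_const hp).inter ?_
  exact (measurable_measure_prodMk_left (ν := densityMeasure p) hs) measurableSet_Ioi

-- Fubini exchanges the two almost-everywhere quantifiers, turning positivity of forward proposals
-- into positivity of the backward ones that enter the acceptance ratio.
omit [SFinite (volume : Measure S)] in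
lemma ae_mem_proposablePoints [IsProbabilityMeasure (densityMeasure p)] (hp : Measurable p)
    (hq : IsProposal q) (hirr : IrreducibleProposal p q) :
    ∀ᵐ x ∂densityMeasure p, x ∈ proposablePoints p q := by
  have h1 : ∀ᵐ y ∂densityMeasure p, ∀ᵐ x ∂densityMeasure p, 0 < q y x :=
    (ae_densityMeasure_pos hp).mono fun y hy => ae_proposal_pos hq hirr hy
  rw [Measure.ae_ae_comm (p := fun y x => 0 < q y x) (measurableSet_lt measurable_const hq.meas)] at h1
  filter_upwards [ae_densityMeasure_pos hp, h1] with x hx hx' using ⟨hx, hx'⟩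

omit [SFinite (volume : Measure S)] in
lemma proposablePoints_subset [IsProbabilityMeasure (densityMeasure p)] :
    proposablePoints p q ⊆ startingPoints p q := fun x hx =>
  ⟨hx.1, by
    have : densityMeasure p {y | 0 < q y x} = 1 := by
      refine (measure_congr (?_ : _ =ᵐ[_] Set.univ)).trans measure_univ
      exact eventuallyEq_univ.2 hx.2
    rw [this]; exact one_pos⟩

omit [SFinite (volume : Measure S)] in
lemma ae_mem_startingPoints [IsProbabilityMeasure (densityMeasure p)] (hp : Measurable p)
    (hq : IsProposal q) (hirr : IrreducibleProposal p q) :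
    ∀ᵐ x ∂densityMeasure p, x ∈ startingPoints p q :=
  (ae_mem_proposablePoints hp hq hirr).mono fun _ h => proposablePoints_subset h

omit [SFinite (volume : Measure S)] in
lemma measurable_acceptReject_firstAccept (hpm : Measurable pm) (hq : IsProposal q) (x : S) :
    Measurable fun y => acceptReject (firstAccept pm q x y) y x :=
  measurable_acceptReject ((measurable_firstAccept_const hpm hq).comp measurable_prodMk_left)
    measurable_id measurable_const

-- Where `q` is positive in both directions and `p` is positive, the acceptance probability is
-- positive, and no set of positive posterior mass is missed by the proposal.
omit [SFinite (volume : Measure S)] in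
lemma firstStageStep_pos (h : SamePositivity p pm) (hq : IsProposal q) {x : S} (hx : 0 < p x)
    {A : Set S} (hA : MeasurableSet A)
    (hpos : 0 < densityMeasure p (A ∩ {y | 0 < q x y ∧ 0 < q y x})) :
    0 < firstStageStep pm q x A := by
  have hqx : Measurable (q x) := hq.meas.comp measurable_prodMk_left
  refine bind_apply_pos (measurable_acceptReject_firstAccept h.meas_right hq x) hA
    (C := A ∩ {y | 0 < q x y ∧ 0 < q y x} ∩ {y | 0 < p y}) ?_ (ae_of_all _ ?_)
  · rw [pos_iff_ne_zero] at hpos ⊢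
    rw [Ne, densityMeasure_eq_zero_iff h.meas_left] at hpos
    rw [Ne, densityMeasure_eq_zero_iff hqx]
    refine fun h0 => hpos (measure_mono_null ?_ h0)
    exact fun y hy => ⟨hy.2.2.1, hy.2, hy.1⟩
  · rintro y ⟨⟨hyA, hxy, hyx⟩, hpy⟩
    rw [acceptReject_apply _ _ _ hA]
    have h1 := (h.pos_iff x).1 hx
    have h2 := (h.pos_iff y).1 hpy
    have : 0 < firstAccept pm q x y := lt_min one_pos (by positivity)
    simp [hyA, this]

-- A proposal falls into a posterior-null set `B` almost surely only at points where `p` vanishes.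
-- There `pm` vanishes too, so the proposal is rejected.
omit [SFinite (volume : Measure S)] in
lemma nullAvoiding_firstStageStep (h : SamePositivity p pm) (hq : IsProposal q) :
    NullAvoiding (densityMeasure p) (firstStageStep pm q) := by
  intro x B hB hp hx
  have hqx : Measurable (q x) := hq.meas.comp measurable_prodMk_left
  rw [densityMeasure_eq_zero_iff h.meas_left] at hp
  have hae : ∀ᵐ y ∂densityMeasure (q x), y ∉ {y | 0 < p y} ∩ B :=
    measure_eq_zero_iff_ae_notMem.1
      ((withDensity_absolutelyContinuous volume _) hp)
  refine bind_apply_eq_zero (measurable_acceptReject_firstAccept h.meas_right hq x) hB ?_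
  filter_upwards [hae] with y hy
  rw [acceptReject_apply _ _ _ hB]
  by_cases hyB : y ∈ B
  · have h1 : ¬ 0 < pm y := fun h' => hy ⟨(h.pos_iff y).2 h', hyB⟩
    have h2 : pm y = 0 := le_antisymm (not_lt.1 h1) (h.nonneg_right y)
    simp [firstAccept, h2, hx]
  · simp [hyB, hx]

lemma nullAvoiding_delayedStep (h : SamePositivity p pm) (hq : IsProposal q) (L : ℕ) :
    NullAvoiding (densityMeasure p) (delayedStep p pm q L) :=
  ((nullAvoiding_firstStageStep h hq).subchain (measurable_firstStageStep_const h.meas_right hq)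
    (isProbabilityMeasure_firstStageStep h.meas_right h.nonneg_right hq) .empty
    L).bind_acceptReject (measurable_secondAccept_const h)

omit [SFinite (volume : Measure S)] in
lemma delayedStep_pos_of_nStep_pos (h : SamePositivity p pm) {L : ℕ} {x : S} (hx : 0 < p x)
    {A : Set S} (hA : MeasurableSet A)
    (hpos : 0 < nStep (firstStageStep pm q) L x (A ∩ {y | 0 < p y})) :
    0 < delayedStep p pm q L x A := by
  rw [delayedStep, subchain_empty]
  refine bind_apply_pos (measurable_acceptReject
    ((measurable_secondAccept_const h).comp measurable_prodMk_left) measurable_id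
    measurable_const) hA hpos (ae_of_all _ ?_)
  rintro y ⟨hyA, hpy⟩
  rw [acceptReject_apply _ _ _ hA]
  have hpy' : 0 < p y := hpy
  have h1 := (h.pos_iff x).1 hx
  have h2 := (h.pos_iff y).1 hpy
  have : 0 < secondAccept p pm x y := lt_min one_pos (by positivity)
  simp [hyA, Function.uncurry, this]

variable [IsProbabilityMeasure (densityMeasure p)]

/-- From a proposable point all sets of positive probability are reached in one step. -/
lemma delayedStep_pos (h : SamePositivity p pm) (hq : IsProposal q)
    (hirr : IrreducibleProposal p q) {L : ℕ} (hL : 1 ≤ L) {x : S} (hx : x ∈ proposablePoints p q)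
    {A : Set S} (hA : MeasurableSet A) (hpos : 0 < densityMeasure p A) :
    0 < delayedStep p pm q L x A := by
  obtain ⟨n, rfl⟩ := Nat.exists_eq_add_of_le' hL
  have := isMarkovKernel_firstStageKernel h hq
  have hpm : MeasurableSet {y | 0 < p y} := measurableSet_lt measurable_const h.meas_left
  refine delayedStep_pos_of_nStep_pos h hx.1 hA ?_
  refine nStep_succ_pos (κ := firstStageKernel h.meas_right hq) (nullAvoiding_firstStageStep h hq)
    (measurableSet_proposablePoints h.meas_left hq)
    (mem_ae_iff.1 (ae_mem_proposablePoints h.meas_left hq hirr)) (hA.inter hpm)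
    (fun y hy => firstStageStep_pos h hq hy.1 (hA.inter hpm) ?_) n x hx
  -- For a proposable `y` the positivity constraints hold almost everywhere and remove nothing from
  -- `A`.
  rw [measure_congr (?_ : _ =ᵐ[densityMeasure p] A)]
  · exact hpos
  · filter_upwards [ae_densityMeasure_pos h.meas_left, hy.2, ae_proposal_pos hq hirr hy.1]
      with z h1 h2 h3
    exact propext ⟨fun hz => hz.1.1, fun hz => ⟨⟨hz, h1⟩, h3, h2⟩⟩

/-- From a starting point all sets of full probability are charged in one step. -/
lemma delayedStep_pos_of_null_compl (h : SamePositivity p pm) (hq : IsProposal q)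
    (hirr : IrreducibleProposal p q) {L : ℕ} (hL : 1 ≤ L) {x : S} (hx : x ∈ startingPoints p q)
    {B : Set S} (hB : MeasurableSet B) (hnull : densityMeasure p Bᶜ = 0) :
    0 < delayedStep p pm q L x B := by
  obtain ⟨n, rfl⟩ := Nat.exists_eq_add_of_le' hL
  have := isMarkovKernel_firstStageKernel h hq
  have hpm : MeasurableSet {y | 0 < p y} := measurableSet_lt measurable_const h.meas_left
  refine delayedStep_pos_of_nStep_pos h hx.1 hB ?_
  refine nStep_succ_pos (κ := firstStageKernel h.meas_right hq) (nullAvoiding_firstStageStep h hq)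
    (measurableSet_startingPoints h.meas_left hq)
    (mem_ae_iff.1 (ae_mem_startingPoints h.meas_left hq hirr)) (hB.inter hpm)
    (fun y hy => firstStageStep_pos h hq hy.1 (hB.inter hpm) ?_) n x hx
  -- From a mere starting point only the backward constraint can cut the set down; what it leaves
  -- has positive mass by definition of `startingPoints`.
  rw [measure_congr (?_ : _ =ᵐ[densityMeasure p] {z | 0 < q z y})]
  · exact hy.2
  · filter_upwards [ae_densityMeasure_pos h.meas_left, mem_ae_iff.2 hnull,
      ae_proposal_pos hq hirr hy.1] with z h1 h2 h3
    exact propext ⟨fun hz => hz.2.2, fun hz => ⟨⟨h2, h1⟩, h3, hz⟩⟩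

/-- Two steps suffice: the first enters the full set of proposable points, from which the second
reaches `A`. -/
lemma irreducibleOn_delayedStep (h : SamePositivity p pm) (hq : IsProposal q)
    (hirr : IrreducibleProposal p q) {L : ℕ} (hL : 1 ≤ L) :
    IrreducibleOn (densityMeasure p) (delayedStep p pm q L) (startingPoints p q) := by
  intro x hx A hA hpos
  have hP := measurable_delayedStep_const h hq L
  refine ⟨2, one_le_two, ?_⟩
  have hC := delayedStep_pos_of_null_compl h hq hirr hL hx
    (measurableSet_proposablePoints h.meas_left hq)
    (mem_ae_iff.1 (ae_mem_proposablePoints h.meas_left hq hirr))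
  refine bind_apply_pos (measurable_nStep hP 1) hA hC (ae_of_all _ fun y hy => ?_)
  rw [nStep_one]
  exact delayedStep_pos h hq hirr hL hy hA hpos

/-- A proposable point of `A 0` returns to `A 0` in one step with positive probability, which a
cycle through disjoint sets forbids. -/
lemma aperiodic_delayedStep (h : SamePositivity p pm) (hq : IsProposal q)
    (hirr : IrreducibleProposal p q) {L : ℕ} (hL : 1 ≤ L) :
    Aperiodic (densityMeasure p) (delayedStep p pm q L) := by
  rintro ⟨d, A, hd, hA, hdisj, hpos, hcyc⟩
  obtain ⟨x, hxA, hx⟩ : ∃ x ∈ A 0, x ∈ proposablePoints p q := by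
    by_contra! hne
    refine hpos.ne' (measure_mono_null (t := (proposablePoints p q)ᶜ) (fun x hx => hne x hx) ?_)
    exact mem_ae_iff.1 (ae_mem_proposablePoints h.meas_left hq hirr)
  have := isProbabilityMeasure_delayedStep h hq L x
  have h0 := delayedStep_pos h hq hirr hL hx (hA 0 (by omega)) hpos
  have h1 := hcyc 0 (by omega) x hxA
  rw [Nat.zero_add, Nat.mod_eq_of_lt (by omega : 1 < d)] at h1
  have h2 : delayedStep p pm q L x (A 0) ≤ delayedStep p pm q L x (A 1)ᶜ :=
    measure_mono (hdisj 0 (by omega) 1 (by omega) (by omega)).subset_compl_right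
  rw [prob_compl_eq_one_sub (hA 1 (by omega)), h1, tsub_self] at h2
  exact h0.not_ge h2

theorem tendsto_tvDist_delayedStep [MeasurableSingletonClass S]
    [IsFiniteMeasure (densityMeasure pm)] (h : SamePositivity p pm) (hq : IsProposal q)
    (hirr : IrreducibleProposal p q) {L : ℕ} (hL : 1 ≤ L) {x : S} (hx : x ∈ startingPoints p q) :
    Tendsto (fun n => tvDist (nStep (delayedStep p pm q L) n x) (densityMeasure p)) atTop
      (𝓝 0) := by
  have := isMarkovKernel_delayedKernel h hq L
  refine tendsto_tvDist_nStep (κ := delayedKernel h hq L) (detailedBalance_delayedStep h hq L) ?_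
    (nullAvoiding_delayedStep h hq L)
    fun B hB hnull => delayedStep_pos_of_null_compl h hq hirr hL hx hB hnull
  filter_upwards [ae_mem_proposablePoints h.meas_left hq hirr] with y hy
  refine Measure.AbsolutelyContinuous.mk fun A hA h0 => ?_
  by_contra hne
  exact (delayedStep_pos h hq hirr hL hy hA (pos_iff_ne_zero.2 hne)).ne' h0

end Positivity

/-! ### Posterior densities -/

section Posterior

variable {Nd : ℕ} (Sig : Matrix (Fin Nd) (Fin Nd) ℝ) (dobs : Obs Nd)

lemma measurable_whiten : Measurable (whiten Sig) := by
  have : Continuous (whiten Sig) := by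
    unfold whiten
    exact Continuous.matrix_mulVec continuous_const (PiLp.continuous_ofLp 2 _)
  exact this.measurable

lemma measurable_misfit {T : Type*} [MeasurableSpace T] {F : T → Obs Nd} (hF : Measurable F) :
    Measurable (misfit Sig dobs F) := by
  have h1 : Measurable fun x => whiten Sig (F x - dobs) :=
    (measurable_whiten Sig).comp (hF.sub_const dobs)
  have h2 : Measurable fun x => (WithLp.toLp 2 (whiten Sig (F x - dobs)) : Obs Nd) :=
    (PiLp.continuous_toLp 2 _).measurable.comp h1
  exact (h2.norm.pow_const 2).const_mul (1 / 2)

lemma misfit_nonneg {T : Type*} (F : T → Obs Nd) (x : T) : 0 ≤ misfit Sig dobs F x := by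
  unfold misfit; positivity

variable {S : Type*} [MeasureSpace S] {pr : S → ℝ} (hpr : Measurable pr) (hpr0 : ∀ x, 0 ≤ pr x)
  (hpr1 : ∫ x, pr x = 1) {F : S → Obs Nd} (hF : Measurable F)

include hpr hpr0 hpr1 hF

lemma integrable_likelihood_mul_prior :
    Integrable fun x => Real.exp (-misfit Sig dobs F x) * pr x := by
  -- The integral of a non-integrable function is 0 by convention, so the value 1 forces
  -- integrability.
  have hint : Integrable pr := by
    by_contra h
    rw [integral_undef h] at hpr1
    exact zero_ne_one hpr1
  refine hint.mono' ((measurable_misfit Sig dobs hF).neg.exp.mul hpr).aestronglyMeasurable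
    (ae_of_all _ fun x => ?_)
  rw [Real.norm_of_nonneg (mul_nonneg (Real.exp_pos _).le (hpr0 x))]
  exact mul_le_of_le_one_left (hpr0 x)
    (Real.exp_le_one_iff.2 (neg_nonpos.2 (misfit_nonneg Sig dobs F x)))

/-- The likelihood is strictly positive, so a zero integral would make the prior vanish almost
everywhere. -/
lemma normalization_pos : 0 < ∫ x, Real.exp (-misfit Sig dobs F x) * pr x := by
  have h0 : ∀ x, 0 ≤ Real.exp (-misfit Sig dobs F x) * pr x := fun x =>
    mul_nonneg (Real.exp_pos _).le (hpr0 x)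
  refine (integral_nonneg h0).lt_of_ne fun h => ?_
  have hae := (integral_eq_zero_iff_of_nonneg h0
    (integrable_likelihood_mul_prior Sig dobs hpr hpr0 hpr1 hF)).1 h.symm
  have : ∫ x, pr x = 0 := by
    refine integral_eq_zero_of_ae ?_
    filter_upwards [hae] with x hx
    exact (mul_eq_zero.1 hx).resolve_left (Real.exp_pos _).ne'
  exact zero_ne_one (this.symm.trans hpr1)

/-- The forward model does not influence the support; hence full and approximate posteriors are
positive at the same points, however poor the reduced model. -/
lemma posteriorDensity_pos_iff (x : S) : 0 < posteriorDensity Sig dobs pr F x ↔ 0 < pr x := by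
  have hZ := normalization_pos Sig dobs hpr hpr0 hpr1 hF
  rw [posteriorDensity, mul_pos_iff_of_pos_left (inv_pos.2 hZ),
    mul_pos_iff_of_pos_left (Real.exp_pos _)]

omit hpr0 hpr1 in
lemma measurable_posteriorDensity : Measurable (posteriorDensity Sig dobs pr F) :=
  ((measurable_misfit Sig dobs hF).neg.exp.mul hpr).const_mul _

lemma isProbabilityMeasure_posterior :
    IsProbabilityMeasure (densityMeasure (posteriorDensity Sig dobs pr F)) := by
  have hZ := normalization_pos Sig dobs hpr hpr0 hpr1 hF
  have hi := integrable_likelihood_mul_prior Sig dobs hpr hpr0 hpr1 hF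
  constructor
  simp only [densityMeasure, withDensity_apply _ .univ, Measure.restrict_univ, posteriorDensity]
  rw [← ofReal_integral_eq_lintegral_ofReal (hi.const_mul _) (ae_of_all _ fun x =>
      mul_nonneg (inv_nonneg.2 hZ.le) (mul_nonneg (Real.exp_pos _).le (hpr0 x))),
    integral_const_mul, inv_mul_cancel₀ hZ.ne', ENNReal.ofReal_one]

omit hpr hpr1 hF in
lemma posteriorDensity_nonneg (F : S → Obs Nd) (x : S) : 0 ≤ posteriorDensity Sig dobs pr F x :=
  mul_nonneg (inv_nonneg.2 (integral_nonneg fun x => mul_nonneg (Real.exp_pos _).le (hpr0 x)))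
    (mul_nonneg (Real.exp_pos _).le (hpr0 x))

lemma samePositivity_posteriorDensity {G : S → Obs Nd} (hG : Measurable G) :
    SamePositivity (posteriorDensity Sig dobs pr F) (posteriorDensity Sig dobs pr G) where
  meas_left := measurable_posteriorDensity Sig dobs hpr hF
  meas_right := measurable_posteriorDensity Sig dobs hpr hG
  nonneg_left := posteriorDensity_nonneg Sig dobs hpr0 F
  nonneg_right := posteriorDensity_nonneg Sig dobs hpr0 G
  pos_iff x := (posteriorDensity_pos_iff Sig dobs hpr hpr0 hpr1 hF x).trans
    (posteriorDensity_pos_iff Sig dobs hpr hpr0 hpr1 hG x).symm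

omit hpr0 hpr1 hF in
lemma measurable_posteriorDensity_param [SFinite (volume : Measure S)] {E : Type*}
    [MeasurableSpace E] {G : E → S → Obs Nd} (hG : Measurable (Function.uncurry G)) :
    Measurable (Function.uncurry fun s => posteriorDensity Sig dobs pr (G s)) := by
  have h : Measurable fun s : E × S => Real.exp (-misfit Sig dobs (G s.1) s.2) * pr s.2 :=
    (measurable_misfit Sig dobs hG).neg.exp.mul (hpr.comp measurable_snd)
  have hZ : Measurable fun s : E => ∫ z, Real.exp (-misfit Sig dobs (G s) z) * pr z :=
    (h.stronglyMeasurable.integral_prod_right' (ν := (volume : Measure S))).measurable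
  exact ((hZ.comp measurable_fst).inv).mul h

end Posterior

/-! ### Measurability and finite adaptation of the adaptive algorithm -/

section Adaptive

variable {S : Type*} {Ns Nd : ℕ}

lemma measurable_orthogonalPart :
    Measurable fun s : ReducedBasis Ns × State Ns => orthogonalPart s.1 s.2 := by
  -- The number of summands depends on the basis; since dimensions are countable, it can be frozen.
  have h : ∀ m : ℕ, Measurable fun s : (ℕ → State Ns) × State Ns =>
      orthogonalPart ((m, s.1) : ReducedBasis Ns) s.2 := fun m => by
    have h2 : Measurable fun s : (ℕ → State Ns) × State Ns => s.2 := measurable_snd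
    have h1 : ∀ i, Measurable fun s : (ℕ → State Ns) × State Ns => s.1 i := fun i =>
      (measurable_pi_apply i).comp measurable_fst
    have h3 : ∀ i, Measurable fun s : (ℕ → State Ns) × State Ns =>
        (inner ℝ (s.1 i) s.2 : ℝ) • s.1 i := fun i =>
      ((h1 i).inner (𝕜 := ℝ) h2).smul (h1 i)
    exact h2.sub (Finset.measurable_fun_sum (Finset.range m) fun i _ => h3 i)
  have h' : Measurable fun s : ℕ × ((ℕ → State Ns) × State Ns) =>
      orthogonalPart ((s.1, s.2.1) : ReducedBasis Ns) s.2.2 :=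
    measurable_from_prod_countable_right h
  exact h'.comp (f := fun s : ReducedBasis Ns × State Ns => (s.1.1, (s.1.2, s.2))) (by fun_prop)

lemma measurable_enrich :
    Measurable fun s : ReducedBasis Ns × State Ns => enrich s.1 s.2 := by
  have ho := measurable_orthogonalPart (Ns := Ns)
  refine Measurable.ite (ho (measurableSet_singleton 0)) measurable_fst ?_
  have hdim : Measurable fun s : ReducedBasis Ns × State Ns => s.1.1 :=
    measurable_fst.comp measurable_fst
  refine (hdim.add_const 1).prodMk (measurable_pi_iff.2 fun i => ?_)
  have hi : Measurable fun s : ReducedBasis Ns × State Ns => s.1.2 i :=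
    (measurable_pi_apply i).comp (measurable_snd.comp measurable_fst)
  simp only [Function.update_apply]
  refine Measurable.ite ?_ (ho.norm.inv.smul ho) hi
  exact measurableSet_eq_fun measurable_const hdim

lemma enrich_dim_le (V : ReducedBasis Ns) (v : State Ns) : (enrich V v).1 ≤ V.1 + 1 := by
  unfold enrich
  split_ifs <;> simp

variable {a : AdaptiveData S Ns Nd}

/-- The cap on the dimension bounds the denominator by `M + 1`, so the criterion holds from a time
that depends neither on the basis nor on the path. -/
lemma AdaptiveData.finiteAdaptation_of_le {m₀ n : ℕ} {V : ReducedBasis Ns}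
    (hV : V.1 ≤ max a.M m₀) (hn : (a.M + 1) * (1 / (a.c * a.ε)) < n) :
    a.finiteAdaptation m₀ n V := by
  unfold AdaptiveData.finiteAdaptation
  have h1 : max 1 (V.1 - m₀) ≤ a.M + 1 := by omega
  have h2 : (0 : ℝ) < (max 1 (V.1 - m₀) : ℕ) := by exact_mod_cast (by omega : 0 < max 1 (V.1 - m₀))
  rw [lt_div_iff₀ h2]
  have h1' : ((max 1 (V.1 - m₀) : ℕ) : ℝ) ≤ a.M + 1 := by exact_mod_cast h1
  have hn0 : (0 : ℝ) ≤ n := Nat.cast_nonneg n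
  -- A negative threshold is exceeded trivially.
  rcases le_or_gt 0 (1 / (a.c * a.ε)) with h | h
  · calc _ ≤ 1 / (a.c * a.ε) * (a.M + 1) := by gcongr
      _ < n := by linarith
  · exact (mul_neg_of_neg_of_pos h h2).trans_le hn0

/-- Enrichment adds at most one vector, and only below dimension `M`. The maximum allows for an
initial basis that is already larger. -/
lemma AdaptiveData.nextBasis_dim_le {m₀ n : ℕ} {V : ReducedBasis Ns} (hV : V.1 ≤ max a.M m₀)
    (x' xn : S) : (a.nextBasis m₀ n V x' xn).1 ≤ max a.M m₀ := by
  unfold AdaptiveData.nextBasis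
  split_ifs with h
  · exact (enrich_dim_le _ _).trans (by have := h.2.1; omega)
  · exact hV

lemma measurableSet_finiteAdaptation (m₀ n : ℕ) :
    MeasurableSet {V : ReducedBasis Ns | a.finiteAdaptation m₀ n V} :=
  (measurable_fst : Measurable fun V : ReducedBasis Ns => V.1)
    (MeasurableSet.of_discrete
      (s := {m : ℕ | 1 / (a.c * a.ε) < (n : ℝ) / (max 1 (m - m₀) : ℕ)}))

end Adaptive

/-! ### Ergodicity of the adaptive algorithm -/

section AdaptiveChain

variable {S : Type*} [MeasureSpace S] {Ns Nd : ℕ}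

/-- Regularity of the data of the adaptive algorithm. -/
structure AdaptiveData.IsRegular (a : AdaptiveData S Ns Nd) : Prop where
  pm : Measurable (Function.uncurry a.pm)
  samePositivity : ∀ V, SamePositivity a.p (a.pm V)
  q : IsProposal a.q
  u : Measurable a.u
  t : Measurable (Function.uncurry a.t)
  tInd : Measurable (Function.uncurry a.tInd)

variable {a : AdaptiveData S Ns Nd}

lemma AdaptiveData.IsRegular.measurableSet_breakSet (ha : a.IsRegular) (m₀ n : ℕ) :
    MeasurableSet {s : ReducedBasis Ns × S | s.2 ∈ a.breakSet m₀ n s.1} :=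
  MeasurableSet.inter (s₁ := {s : ReducedBasis Ns × S | ¬ a.finiteAdaptation m₀ n s.1})
    (s₂ := {s | a.ε ≤ ‖Function.uncurry a.tInd s‖})
    (measurable_fst (measurableSet_finiteAdaptation m₀ n).compl)
    (measurableSet_le measurable_const ha.tInd.norm)

lemma AdaptiveData.IsRegular.measurable_nextBasis (ha : a.IsRegular) (m₀ n : ℕ) :
    Measurable fun s : (ReducedBasis Ns × S) × S => a.nextBasis m₀ n s.1.1 s.1.2 s.2 := by
  have hV : Measurable fun s : (ReducedBasis Ns × S) × S => s.1.1 :=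
    measurable_fst.comp measurable_fst
  have ht : Measurable fun s : (ReducedBasis Ns × S) × S => a.t s.1.1 s.2 :=
    ha.t.comp (f := fun s : (ReducedBasis Ns × S) × S => (s.1.1, s.2)) (by fun_prop)
  have hu : Measurable fun s : (ReducedBasis Ns × S) × S => (s.1.1, a.u s.1.2) :=
    hV.prodMk (ha.u.comp (measurable_snd.comp measurable_fst))
  refine Measurable.ite ?_ (measurable_enrich.comp hu) hV
  refine (hV (measurableSet_finiteAdaptation m₀ n).compl).inter (MeasurableSet.inter ?_ ?_)
  · exact measurableSet_lt (measurable_fst.comp hV) measurable_const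
  · exact measurableSet_le measurable_const ht.norm

/-- The conditional law of state and basis after one step, given the candidate. -/
def AdaptiveData.outcome (a : AdaptiveData S Ns Nd) (m₀ n : ℕ) (s : S × ReducedBasis Ns) (x' : S) :
    Measure (S × ReducedBasis Ns) :=
  acceptReject (secondAccept a.p (a.pm s.2) s.1 x')
    (x', a.nextBasis m₀ n s.2 x' x') (s.1, a.nextBasis m₀ n s.2 x' s.1)

lemma AdaptiveData.IsRegular.measurable_outcome (ha : a.IsRegular) (m₀ n : ℕ) :
    Measurable (Function.uncurry (a.outcome m₀ n)) := by
  have hβ : Measurable fun s : (S × ReducedBasis Ns) × S =>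
      secondAccept a.p (a.pm s.1.2) s.1.1 s.2 :=
    (measurable_secondAccept (ha.samePositivity (0, fun _ => 0)).meas_left ha.pm).comp
      (f := fun s : (S × ReducedBasis Ns) × S => ((s.1.2, s.1.1), s.2)) (by fun_prop)
  have h1 : Measurable fun s : (S × ReducedBasis Ns) × S => a.nextBasis m₀ n s.1.2 s.2 s.2 :=
    (ha.measurable_nextBasis m₀ n).comp
      (f := fun s : (S × ReducedBasis Ns) × S => ((s.1.2, s.2), s.2)) (by fun_prop)
  have h2 : Measurable fun s : (S × ReducedBasis Ns) × S => a.nextBasis m₀ n s.1.2 s.2 s.1.1 :=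
    (ha.measurable_nextBasis m₀ n).comp
      (f := fun s : (S × ReducedBasis Ns) × S => ((s.1.2, s.2), s.1.1)) (by fun_prop)
  exact measurable_acceptReject hβ (measurable_snd.prodMk h1)
    ((measurable_fst.comp measurable_fst).prodMk h2)

variable [SFinite (volume : Measure S)]

lemma AdaptiveData.IsRegular.isProbabilityMeasure_subchain (ha : a.IsRegular) (m₀ n : ℕ)
    (s : S × ReducedBasis Ns) : IsProbabilityMeasure
      (subchain (firstStageStep (a.pm s.2) a.q) (a.breakSet m₀ n s.2) a.L s.1) :=
  isProbabilityMeasure_subchain_firstStage ha.pm (fun V => (ha.samePositivity V).nonneg_right) ha.q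
    (ha.measurableSet_breakSet m₀ n) a.L s.2 s.1

lemma AdaptiveData.IsRegular.measurable_step (ha : a.IsRegular) (m₀ n : ℕ) :
    Measurable (a.step m₀ n) := by
  have := ha.isProbabilityMeasure_subchain m₀ n
  have h := (measurable_subchain_firstStage ha.pm (fun V => (ha.samePositivity V).nonneg_right)
    ha.q (ha.measurableSet_breakSet m₀ n) a.L).comp (measurable_swap (α := S))
  exact measurable_bind_param (κ := fun s : S × ReducedBasis Ns =>
    subchain (firstStageStep (a.pm s.2) a.q) (a.breakSet m₀ n s.2) a.L s.1) h
    (ha.measurable_outcome m₀ n)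

lemma AdaptiveData.IsRegular.isProbabilityMeasure_step (ha : a.IsRegular) (m₀ n : ℕ)
    (s : S × ReducedBasis Ns) : IsProbabilityMeasure (a.step m₀ n s) := by
  have := ha.isProbabilityMeasure_subchain m₀ n s
  have h := (ha.measurable_outcome m₀ n).comp (measurable_prodMk_left (x := s))
  exact isProbabilityMeasure_bind (g := a.outcome m₀ n s) h fun x' => isProbabilityMeasure_acceptReject
      (secondAccept_nonneg (ha.samePositivity s.2).nonneg_left (ha.samePositivity s.2).nonneg_right
        _ _) (min_le_left _ _) _ _

lemma AdaptiveData.IsRegular.isProbabilityMeasure_law (ha : a.IsRegular) (x₀ : S)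
    (V₀ : ReducedBasis Ns) (n : ℕ) : IsProbabilityMeasure (a.law x₀ V₀ n) := by
  induction n with
  | zero => exact Measure.dirac.isProbabilityMeasure
  | succ n ih =>
    exact isProbabilityMeasure_bind (ha.measurable_step _ n) (ha.isProbabilityMeasure_step _ n)

/-- The states that the adaptive algorithm can visit: admissible starting points, with bases of
bounded dimension. -/
def AdaptiveData.reachable (a : AdaptiveData S Ns Nd) (m₀ : ℕ) : Set (S × ReducedBasis Ns) :=
  {s | s.1 ∈ startingPoints a.p a.q ∧ s.2.1 ≤ max a.M m₀}

variable [IsProbabilityMeasure (densityMeasure a.p)]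

omit [SFinite (volume : Measure S)] in
lemma AdaptiveData.IsRegular.measurableSet_reachable (ha : a.IsRegular) (m₀ : ℕ) :
    MeasurableSet (a.reachable m₀) := by
  have h := measurableSet_startingPoints (ha.samePositivity (0, fun _ => 0)).meas_left ha.q
  exact (measurable_fst h).inter
    (measurableSet_le (measurable_fst.comp measurable_snd) measurable_const)

/-- The starting points have full measure, so by null avoidance even a subchain that is stopped
early ends in them almost surely. The new state is this candidate or the old state. -/
lemma AdaptiveData.IsRegular.step_reachable_compl (ha : a.IsRegular)
    (hirr : IrreducibleProposal a.p a.q) (m₀ n : ℕ) {s : S × ReducedBasis Ns}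
    (hs : s ∈ a.reachable m₀) : a.step m₀ n s (a.reachable m₀)ᶜ = 0 := by
  have h := ha.samePositivity s.2
  have hG := measurableSet_startingPoints h.meas_left ha.q
  have hbrk : MeasurableSet (a.breakSet m₀ n s.2) :=
    (measurable_prodMk_left (x := s.2)) (ha.measurableSet_breakSet m₀ n)
  have hae : ∀ᵐ x' ∂subchain (firstStageStep (a.pm s.2) a.q) (a.breakSet m₀ n s.2) a.L s.1,
      x' ∈ startingPoints a.p a.q :=
    mem_ae_iff.2 ((nullAvoiding_firstStageStep h ha.q).subchain
      (measurable_firstStageStep_const h.meas_right ha.q)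
      (isProbabilityMeasure_firstStageStep h.meas_right h.nonneg_right ha.q) hbrk a.L s.1 _
      hG.compl (mem_ae_iff.1 (ae_mem_startingPoints h.meas_left ha.q hirr)) fun h' => h' hs.1)
  refine bind_apply_eq_zero ((ha.measurable_outcome m₀ n).comp measurable_prodMk_left)
    (ha.measurableSet_reachable m₀).compl ?_
  filter_upwards [hae] with x' hx'
  have h1 : (x', a.nextBasis m₀ n s.2 x' x') ∈ a.reachable m₀ :=
    ⟨hx', AdaptiveData.nextBasis_dim_le hs.2 _ _⟩
  have h2 : (s.1, a.nextBasis m₀ n s.2 x' s.1) ∈ a.reachable m₀ :=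
    ⟨hs.1, AdaptiveData.nextBasis_dim_le hs.2 _ _⟩
  change acceptReject _ _ _ _ = 0
  rw [acceptReject_apply _ _ _ (ha.measurableSet_reachable m₀).compl]
  simp [h1, h2]

lemma AdaptiveData.IsRegular.ae_law_mem_reachable (ha : a.IsRegular)
    (hirr : IrreducibleProposal a.p a.q) {x₀ : S} (hx₀ : x₀ ∈ startingPoints a.p a.q)
    (V₀ : ReducedBasis Ns) (n : ℕ) : ∀ᵐ s ∂a.law x₀ V₀ n, s ∈ a.reachable V₀.1 := by
  have hR := ha.measurableSet_reachable V₀.1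
  rw [ae_iff]
  change a.law x₀ V₀ n (a.reachable V₀.1)ᶜ = 0
  induction n with
  | zero =>
    have : (x₀, V₀) ∈ a.reachable V₀.1 := ⟨hx₀, le_max_right _ _⟩
    simp [AdaptiveData.law, Measure.dirac_apply' _ hR.compl, this]
  | succ n ih =>
    refine bind_apply_eq_zero (ha.measurable_step _ n) hR.compl ?_
    filter_upwards [mem_ae_iff.2 ih] with s hs using ha.step_reachable_compl hirr _ n hs

omit [SFinite (volume : Measure S)] [IsProbabilityMeasure (densityMeasure a.p)] in
lemma map_acceptReject {T T' : Type*} [MeasurableSpace T] [MeasurableSpace T'] {f : T → T'}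
    (hf : Measurable f) (r : ℝ) (y' y : T) :
    (acceptReject r y' y).map f = acceptReject r (f y') (f y) := by
  simp [acceptReject, Measure.map_add _ _ hf, Measure.map_dirac' hf]

omit [SFinite (volume : Measure S)] [IsProbabilityMeasure (densityMeasure a.p)] in
lemma map_bind {T T' T'' : Type*} [MeasurableSpace T] [MeasurableSpace T'] [MeasurableSpace T'']
    {μ : Measure T} {g : T → Measure T'} (hg : Measurable g) {f : T' → T''} (hf : Measurable f) :
    (μ.bind g).map f = μ.bind fun y => (g y).map f := by
  ext A hA
  rw [Measure.map_apply hf hA, Measure.bind_apply (hf hA) hg.aemeasurable,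
    Measure.bind_apply (f := fun y => (g y).map f) hA
      ((Measure.measurable_map f hf).comp hg).aemeasurable]
  exact lintegral_congr fun y => (Measure.map_apply hf hA).symm

omit [SFinite (volume : Measure S)] [IsProbabilityMeasure (densityMeasure a.p)] in
/-- Once the finite adaptation criterion holds, a step is a delayed acceptance step. -/
lemma AdaptiveData.IsRegular.step_eq_map_delayedStep (ha : a.IsRegular) {m₀ n : ℕ}
    {s : S × ReducedBasis Ns} (hs : a.finiteAdaptation m₀ n s.2) :
    a.step m₀ n s = (delayedStep a.p (a.pm s.2) a.q a.L s.1).map fun y => (y, s.2) := by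
  have hb : a.breakSet m₀ n s.2 = ∅ := by
    ext y; simp [AdaptiveData.breakSet, hs]
  have hV : ∀ x' xn, a.nextBasis m₀ n s.2 x' xn = s.2 := fun x' xn => by
    simp [AdaptiveData.nextBasis, hs]
  rw [AdaptiveData.step, delayedStep, map_bind _ measurable_prodMk_right]
  · simp only [hb, hV, map_acceptReject measurable_prodMk_right]
  · exact measurable_acceptReject
      ((measurable_secondAccept_const (ha.samePositivity s.2)).comp measurable_prodMk_left)
      measurable_id measurable_const

omit [IsProbabilityMeasure (densityMeasure a.p)] in
lemma AdaptiveData.IsRegular.measurable_nStep (ha : a.IsRegular) (k : ℕ) :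
    Measurable fun s : S × ReducedBasis Ns =>
      nStep (delayedStep a.p (a.pm s.2) a.q a.L) k s.1 := by
  induction k with
  | zero => exact Measure.measurable_dirac.comp measurable_fst
  | succ k ih =>
    have h := (measurable_delayedStep (ha.samePositivity (0, fun _ => 0)).meas_left ha.pm
        (fun V => (ha.samePositivity V).nonneg_right) ha.q a.L).comp (measurable_swap (α := S))
    have : ∀ s : S × ReducedBasis Ns,
        IsProbabilityMeasure (delayedStep a.p (a.pm s.2) a.q a.L s.1) := fun s =>
      isProbabilityMeasure_delayedStep (ha.samePositivity s.2) ha.q a.L s.1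
    refine measurable_bind_param
      (κ := fun s : S × ReducedBasis Ns => delayedStep a.p (a.pm s.2) a.q a.L s.1) h
      (g := fun s y => nStep (delayedStep a.p (a.pm s.2) a.q a.L) k y) ?_
    exact ih.comp (f := fun s : (S × ReducedBasis Ns) × S => (s.2, s.1.2)) (by fun_prop)

omit [IsProbabilityMeasure (densityMeasure a.p)] in
lemma AdaptiveData.IsRegular.isProbabilityMeasure_nStep (ha : a.IsRegular) (k : ℕ)
    (s : S × ReducedBasis Ns) :
    IsProbabilityMeasure (nStep (delayedStep a.p (a.pm s.2) a.q a.L) k s.1) := by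
  have := isMarkovKernel_delayedKernel (ha.samePositivity s.2) ha.q a.L
  exact DelayedAcceptance.isProbabilityMeasure_nStep
    (κ := delayedKernel (ha.samePositivity s.2) ha.q a.L) k s.1

omit [IsProbabilityMeasure (densityMeasure a.p)] in
lemma AdaptiveData.IsRegular.measurable_map_nStep (ha : a.IsRegular) (k : ℕ) :
    Measurable fun s : S × ReducedBasis Ns =>
      (nStep (delayedStep a.p (a.pm s.2) a.q a.L) k s.1).map fun y => (y, s.2) := by
  have := ha.isProbabilityMeasure_nStep k
  simp only [← Measure.bind_dirac_eq_map _ measurable_prodMk_right]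
  exact measurable_bind_param (ha.measurable_nStep k)
    (g := fun s y => Measure.dirac (y, s.2)) (Measure.measurable_dirac.comp (by fun_prop))

/-- From time `N` on the criterion holds for every reachable basis, so the basis is frozen and the
remaining steps are those of a homogeneous chain. -/
lemma AdaptiveData.IsRegular.law_add (ha : a.IsRegular)
    (hirr : IrreducibleProposal a.p a.q) {x₀ : S} (hx₀ : x₀ ∈ startingPoints a.p a.q)
    (V₀ : ReducedBasis Ns) {N : ℕ} (hN : (a.M + 1) * (1 / (a.c * a.ε)) < N) (k : ℕ) :
    a.law x₀ V₀ (N + k) = (a.law x₀ V₀ N).bind fun s =>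
      (nStep (delayedStep a.p (a.pm s.2) a.q a.L) k s.1).map fun y => (y, s.2) := by
  induction k with
  | zero =>
    simp only [nStep, Nat.add_zero, Measure.map_dirac' measurable_prodMk_right]
    exact Measure.bind_dirac.symm
  | succ k ih =>
    change (a.law x₀ V₀ (N + k)).bind (a.step V₀.1 (N + k)) = _
    rw [ih, Measure.bind_bind (ha.measurable_map_nStep k).aemeasurable (ha.measurable_step _ _).aemeasurable]
    refine Measure.bind_congr_right ?_
    filter_upwards [ha.ae_law_mem_reachable hirr hx₀ V₀ N] with s hs
    have hP := measurable_delayedStep_const (ha.samePositivity s.2) ha.q a.L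
    have hfa : a.finiteAdaptation V₀.1 (N + k) s.2 :=
      AdaptiveData.finiteAdaptation_of_le hs.2 (hN.trans_le (by push_cast; linarith [(Nat.cast_nonneg k : (0:ℝ) ≤ k)]))
    -- `law` appends steps at the end whereas `nStep` prepends them; hence the splitting `k + 1`.
    rw [nStep_add hP k 1, map_bind (DelayedAcceptance.measurable_nStep hP 1) measurable_prodMk_right,
      ← Measure.bind_dirac_eq_map _ measurable_prodMk_right,
      Measure.bind_bind (f := fun y => Measure.dirac (y, s.2))
        (Measure.measurable_dirac.comp measurable_prodMk_right).aemeasurable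
        (ha.measurable_step _ _).aemeasurable]
    congr 1
    funext y
    rw [Measure.dirac_bind (ha.measurable_step _ _), nStep_one]
    exact ha.step_eq_map_delayedStep (s := (y, s.2)) hfa

/-- Ergodicity of the adaptive algorithm. -/
theorem AdaptiveData.IsRegular.tendsto_tvDist_law [MeasurableSingletonClass S]
    [MeasurableSpace.CountablyGenerated S] (ha : a.IsRegular)
    (hfin : ∀ V, IsFiniteMeasure (densityMeasure (a.pm V)))
    (hirr : IrreducibleProposal a.p a.q) (hL : 1 ≤ a.L) {x₀ : S}
    (hx₀ : x₀ ∈ startingPoints a.p a.q) (V₀ : ReducedBasis Ns) :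
    Tendsto (fun n => tvDist ((a.law x₀ V₀ n).map Prod.fst) (densityMeasure a.p)) atTop (𝓝 0) := by
  obtain ⟨N, hN⟩ := exists_nat_gt ((a.M + 1) * (1 / (a.c * a.ε)))
  let κ : ℕ → Kernel (S × ReducedBasis Ns) S := fun k => ⟨_, ha.measurable_nStep k⟩
  have hκ : ∀ k, IsMarkovKernel (κ k) := fun k => ⟨ha.isProbabilityMeasure_nStep k⟩
  have := ha.isProbabilityMeasure_law x₀ V₀ N
  -- The mixing measure is the joint law of state and basis at the deterministic time `N`. No
  -- uniformity of the convergence over bases is required.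
  have hlim := tendsto_tvDist_bind (μ := a.law x₀ V₀ N) (π := densityMeasure a.p) κ (by
    filter_upwards [ha.ae_law_mem_reachable hirr hx₀ V₀ N] with s hs
    exact tendsto_tvDist_delayedStep (ha.samePositivity s.2) ha.q hirr hL hs.1)
  refine (tendsto_add_atTop_iff_nat N).1 (hlim.congr fun k => ?_)
  rw [add_comm, ha.law_add hirr hx₀ V₀ hN]
  congr 1
  rw [map_bind (ha.measurable_map_nStep k) measurable_fst]
  congr 1
  funext s
  rw [Measure.map_map measurable_fst measurable_prodMk_right]
  exact Measure.map_id.symm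

end AdaptiveChain

end DelayedAcceptance

end

/-! ### Application to posteriors and reduced-basis models -/

open DelayedAcceptance in
theorem mainTheorem3 {Np Nd : ℕ}
    (X : Set (EuclideanSpace ℝ (Fin Np))) (hX : MeasurableSet X)
    -- prior density, noise covariance, data, forward model
    (pr : X → ℝ) (hpr_meas : Measurable pr) (hpr_nonneg : ∀ x, 0 ≤ pr x)
    (hpr_int : ∫ x, pr x = 1)
    (Sig : Matrix (Fin Nd) (Fin Nd) ℝ) (hSig : Sig.PosDef) (dobs : Obs Nd)
    (F : X → Obs Nd) (hF_lip : ∃ K, LipschitzWith K F)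
    (hF_bdd : Bornology.IsBounded (Set.range F))
    -- proposal density and subchain length
    (q : X → X → ℝ) (hq_meas : Measurable (Function.uncurry q)) (hq_nonneg : ∀ x y, 0 ≤ q x y)
    (hq_int : ∀ x, ∫ y, q x y = 1)
    (hq_irr : IrreducibleProposal (posteriorDensity Sig dobs pr F) q)
    (L : ℕ) (hL : 1 ≤ L) :
    -- almost every point is an admissible starting point
    (∀ᵐ x ∂densityMeasure (posteriorDensity Sig dobs pr F),
      x ∈ startingPoints (posteriorDensity Sig dobs pr F) q) ∧
    -- the reduced-order model is held fixed
    (∀ Fm : X → Obs Nd, (∃ K, LipschitzWith K Fm) → Bornology.IsBounded (Set.range Fm) →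
      let p := posteriorDensity Sig dobs pr F
      let P := delayedStep p (posteriorDensity Sig dobs pr Fm) q L
      DetailedBalance (densityMeasure p) P ∧
      IrreducibleOn (densityMeasure p) P (startingPoints p q) ∧
      Aperiodic (densityMeasure p) P ∧
      ∀ x ∈ startingPoints p q,
        Tendsto (fun n => tvDist (nStep P n x) (densityMeasure p)) atTop (𝓝 0)) ∧
    -- the adaptive algorithm
    (∀ (Ns : ℕ) (D : Discretization X Ns Nd) (u : X → State Ns), Measurable u →
      (∀ x, D.residual x (u x) = 0) → (∀ x, F x = D.C (u x) x) →
      ∀ (M : ℕ) (ε c : ℝ), 0 < ε → 0 < c →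
      -- a class of reduced bases that contains all those the algorithm can construct
      ∀ (V₀ : ReducedBasis Ns) (𝓥 : Set (ReducedBasis Ns)), MeasurableSet 𝓥 → V₀ ∈ 𝓥 →
      (∀ V ∈ 𝓥, Orthonormal ℝ fun i : Fin V.1 => V.2 i) →
      (∀ V ∈ 𝓥, V.1 < M → ∀ x, enrich V (u x) ∈ 𝓥) →
      -- the reduced-order models, `w V x` being the reduced state
      ∀ w : ReducedBasis Ns → X → State Ns,
      (∀ V ∈ 𝓥, ∀ x, D.IsGalerkinState V x (w V x)) →
      (Measurable fun s : ReducedBasis Ns × X => D.C (w s.1 s.2) s.2) →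
      (∀ V ∈ 𝓥, (∃ K, LipschitzWith K fun x => D.C (w V x) x) ∧
        Bornology.IsBounded (Set.range fun x => D.C (w V x) x)) →
      -- the error indicator
      ∀ tInd : ReducedBasis Ns → X → (Fin Nd → ℝ), Measurable (Function.uncurry tInd) →
      let p := posteriorDensity Sig dobs pr F
      let a : AdaptiveData X Ns Nd :=
        { p := p
          pm := fun V => posteriorDensity Sig dobs pr fun x => D.C (w V x) x
          q := q
          u := u
          t := fun V x => whiten Sig (F x - D.C (w V x) x)
          tInd := tInd
          L := L
          M := M
          ε := ε
          c := c }
      ∀ x ∈ startingPoints p q,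
        Tendsto (fun n => tvDist ((a.law x V₀ n).map Prod.fst) (densityMeasure p))
          atTop (𝓝 0)) := by
  -- The measure on the subtype is a comap; its push-forward is Lebesgue measure restricted to `X`,
  -- whose σ-finiteness pulls back.
  have hsf : SFinite (volume : Measure X) := by
    have : SigmaFinite (Measure.map Subtype.val (volume : Measure X)) := by
      have e : Measure.map Subtype.val (volume : Measure X) = volume.restrict X :=
        map_comap_subtype_coe hX volume
      rw [e]; infer_instance
    have := SigmaFinite.of_map (volume : Measure X) measurable_subtype_coe.aemeasurable this
    infer_instance
  have hq : IsProposal q :=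
    { meas := hq_meas
      nonneg := hq_nonneg
      prob := fun x => by
        have hint : Integrable (q x) := by
          by_contra h
          have := hq_int x
          rw [integral_undef h] at this
          exact zero_ne_one this
        constructor
        rw [densityMeasure, withDensity_apply _ .univ, Measure.restrict_univ,
          ← ofReal_integral_eq_lintegral_ofReal hint (ae_of_all _ (hq_nonneg x)), hq_int x,
          ENNReal.ofReal_one] }
  have hF : Measurable F := by
    obtain ⟨K, hK⟩ := hF_lip
    exact hK.continuous.measurable
  have hprob {G : X → Obs Nd} (hG : Measurable G) :=
    isProbabilityMeasure_posterior Sig dobs hpr_meas hpr_nonneg hpr_int hG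
  have hsame {G : X → Obs Nd} (hG : Measurable G) :=
    samePositivity_posteriorDensity Sig dobs hpr_meas hpr_nonneg hpr_int hF hG
  have hp := hprob hF
  refine ⟨ae_mem_startingPoints (hsame hF).meas_left hq hq_irr, fun Fm hlip _ => ?_, ?_⟩
  · obtain ⟨K, hK⟩ := hlip
    have hFm : Measurable Fm := hK.continuous.measurable
    have hpm := hprob hFm
    exact ⟨detailedBalance_delayedStep (hsame hFm) hq L,
      irreducibleOn_delayedStep (hsame hFm) hq hq_irr hL,
      aperiodic_delayedStep (hsame hFm) hq hq_irr hL,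
      fun x hx => tendsto_tvDist_delayedStep (hsame hFm) hq hq_irr hL hx⟩
  · intro Ns D u hu _ _ M ε c _ _ V₀ 𝓥 _ _ _ _ w _ hw _ tInd htInd p a x hx
    -- Sections of a jointly measurable map are measurable, which gives `SamePositivity` at every
    -- `V`, as `IsRegular` demands.
    have hV : ∀ V, Measurable fun x => D.C (w V x) x := fun V =>
      hw.comp (measurable_prodMk_left (x := V))
    have ha : a.IsRegular :=
      { pm := measurable_posteriorDensity_param Sig dobs hpr_meas hw
        samePositivity := fun V => hsame (hV V)
        q := hq
        u := hu
        t := (measurable_whiten Sig).comp ((hF.comp measurable_snd).sub hw)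
        tInd := htInd }
    have : IsProbabilityMeasure (densityMeasure a.p) := hp
    exact ha.tendsto_tvDist_law (fun V => have := hprob (hV V); inferInstance) hq_irr hL hx V₀
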